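/- Let $F$ be a skew field (division ring), let $F[t]$ be the polynomial ring over $F$ in an indeterminate $t$ commuting with $F$, and let $F(t)$ be its skew field of fractions (the Ore quotient ring of $F[t]$). For nonzero $p,q\in F[t]$ put $\deg(p/q)=\deg p-\deg q$, and put $\deg 0=-\infty$. A square matrix over $F(t)$ is called nonsingular if it is invertible, proper if all its entries have degree at most $0$, and biproper if it is proper and nonsingular and its inverse is also proper. Every nonsingular matrix $B$ over a skew field $K$ can be written as $B=LDPU$ with $L$ lower unitriangular, $U$ upper unitriangular, $P$ a permutation matrix and $D$ a diagonal matrix with nonzero diagonal entries $d_1,\dots,d_k$, where $DP$ is unique; its Dieudonné determinant is $\operatorname{Det} B=\operatorname{sgn}(P)\,d_1\cdots d_k \bmod [K^\times,K^\times]$. For $K=F(t)$ the degree is zero on commutators, so $\deg\operatorname{Det}B\in\mathbb{Z}$ is defined; put $\deg\operatorname{Det}B=-\infty$ if $B$ is singular. Let $A\in F(t)^{n\times n}$ be nonsingular. Then there are biproper matrices $S,T\in F(t)^{n\times n}$ and integers $\alpha_1\ge\alpha_2\ge\cdots\ge\alpha_n$ such that $$SAT=\operatorname{diag}(t^{\alpha_1},\dots,t^{\alpha_n}).$$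 Moreover, let $\delta_0=0$ and, for $1\le k\le n$, let $\delta_k$ be the maximum of $\deg\operatorname{Det}B$ over all $k\times k$ submatrices $B$ of $A$. Then every $\delta_k$ is finite, and the integers $\alpha_k$ are uniquely determined: for all biproper $S,T$ and integers $\alpha_1\ge\cdots\ge\alpha_n$ with $SAT=\operatorname{diag}(t^{\alpha_1},\dots,t^{\alpha_n})$, one has $$\alpha_k=\delta_k-\delta_{k-1}\qquad(k=1,\dots,n).$$ -/

import Mathlib

open Polynomial nonZeroDivisors

noncomputable section

/-! ### The skew field `F(t)` of rational functions -/

/-- Common left multiples in `F[t]`, for a skew field `F`. -/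
theorem Polynomial.exists_common_left_multiple {F : Type*} [DivisionRing F]
    (r s : F[X]) (hs : s ≠ 0) : ∃ a b : F[X], b ≠ 0 ∧ b * r = a * s := by
  set N := s.natDegree + 1 with hN
  set M := r.natDegree + 1 with hM
  set D := r.natDegree + s.natDegree + 1 with hD
  have key : ∀ (p q : F[X]) (k : ℕ), p ∈ degreeLT F k → k + q.natDegree ≤ D →
      p * q ∈ degreeLT F D := by
    intro p q k hp hk
    rw [mem_degreeLT] at hp ⊢
    by_cases hp0 : p = 0
    · subst hp0
      rw [zero_mul, degree_zero]
      exact WithBot.bot_lt_coe _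
    · have h1 : p.natDegree < k := by
        rwa [degree_eq_natDegree hp0, Nat.cast_lt] at hp
      refine lt_of_le_of_lt degree_le_natDegree ?_
      rw [Nat.cast_lt]
      have := natDegree_mul_le (p := p) (q := q)
      omega
  let f : (degreeLT F N × degreeLT F M) →ₗ[F] degreeLT F D :=
    { toFun := fun x => ⟨x.1.1 * r - x.2.1 * s,
        (degreeLT F D).sub_mem (key _ _ N x.1.2 (by omega)) (key _ _ M x.2.2 (by omega))⟩
      map_add' := by
        intro x y
        ext1
        simp [add_mul]
        abel
      map_smul' := by
        intro c x
        ext1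
        simp [smul_sub, smul_mul_assoc] }
  have hfin : ∀ n, Module.finrank F (degreeLT F n) = n := fun n => by
    rw [(degreeLTEquiv F n).finrank_eq, Module.finrank_fin_fun]
  have hfd : ∀ n, Module.Finite F (degreeLT F n) := fun n =>
    Module.Finite.equiv (degreeLTEquiv F n).symm
  have := hfd N
  have := hfd M
  have := hfd D
  have hker : LinearMap.ker f ≠ ⊥ := by
    apply LinearMap.ker_ne_bot_of_finrank_lt
    rw [Module.finrank_prod, hfin, hfin, hfin]
    omega
  obtain ⟨x, hx, hx0⟩ := (Submodule.ne_bot_iff _).1 hker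
  have hx' : x.1.1 * r = x.2.1 * s := by
    have := congrArg Subtype.val (LinearMap.mem_ker.1 hx)
    exact sub_eq_zero.1 this
  refine ⟨x.2.1, x.1.1, fun h => hx0 ?_, hx'⟩
  rw [h, zero_mul] at hx'
  have h2 : x.2.1 = 0 := (mul_eq_zero.1 hx'.symm).resolve_right hs
  exact Prod.ext (Subtype.ext h) (Subtype.ext h2)

instance Polynomial.instOreSetNonZeroDivisors (F : Type*) [DivisionRing F] :
    OreLocalization.OreSet (F[X]⁰) :=
  Classical.choice <| OreLocalization.nonempty_oreSet_iff_of_noZeroDivisors.2 fun r s => by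
    obtain ⟨a, b, hb, h⟩ :=
      Polynomial.exists_common_left_multiple r (s : F[X]) (nonZeroDivisors.ne_zero s.2)
    exact ⟨a, ⟨b, mem_nonZeroDivisors_of_ne_zero hb⟩, h⟩

/-- The skew field `F(t)` of fractions (Ore quotient ring) of the polynomial ring `F[t]` over a
skew field `F`; in `F[X]` the indeterminate commutes with the coefficients. Mathlib writes the
elements as left fractions `r /ₒ s = s⁻¹ r`; as `F[t]` is both a left and a right Ore domain, this
is the same skew field as that of right fractions `p q⁻¹`. -/
abbrev SkewRatFunc (F : Type*) [DivisionRing F] : Type _ :=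
  OreLocalization (F[X]⁰) F[X]

namespace SkewRatFunc

variable {F : Type*} [DivisionRing F]

/-- The indeterminate `t` as an element of `F(t)`. -/
def t (F : Type*) [DivisionRing F] : SkewRatFunc F := OreLocalization.numeratorHom (X : F[X])

open Classical in
/-- The degree of the fraction `s⁻¹ r`. -/
def fracDegree (r : F[X]) (s : F[X]⁰) : WithBot ℤ :=
  if r = 0 then ⊥ else (((r.natDegree : ℤ) - ((s : F[X]).natDegree : ℤ) : ℤ) : WithBot ℤ)

/-- The degree on `F(t)`: the degree of the numerator minus the degree of the denominator, and
`-∞` at `0`. -/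
def degree (x : SkewRatFunc F) : WithBot ℤ :=
  OreLocalization.liftExpand fracDegree (by
    intro r c s hc
    have hcs : c * (s : F[X]) ≠ 0 := nonZeroDivisors.ne_zero hc
    have hc0 : c ≠ 0 := left_ne_zero_of_mul hcs
    by_cases hr : r = 0
    · simp [fracDegree, hr]
    · have hcr : c * r ≠ 0 := mul_ne_zero hc0 hr
      simp only [fracDegree, smul_eq_mul, hr, hcr, if_false]
      rw [natDegree_mul hc0 hr, natDegree_mul hc0 (right_ne_zero_of_mul hcs)]
      push_cast
      congr 1
      ring) x

theorem degree_oreDiv (r : F[X]) (s : F[X]⁰) :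
    degree (r /ₒ s : SkewRatFunc F) = fracDegree r s := rfl

theorem degree_ne_bot {x : SkewRatFunc F} (hx : x ≠ 0) : degree x ≠ ⊥ := by
  induction x using OreLocalization.ind with
  | c r s =>
    have hr : r ≠ 0 := by
      rintro rfl
      exact hx (OreLocalization.zero_oreDiv s)
    simp [degree_oreDiv, fracDegree, hr]

theorem degree_mul (x y : SkewRatFunc F) : degree (x * y) = degree x + degree y := by
  induction x using OreLocalization.ind with
  | c r s =>
  induction y using OreLocalization.ind with
  | c r' s' =>
    obtain ⟨a, b, hb, h⟩ :=
      Polynomial.exists_common_left_multiple r (s' : F[X]) (nonZeroDivisors.ne_zero s'.2)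
    rw [OreLocalization.oreDiv_mul_char r r' s s' a ⟨b, mem_nonZeroDivisors_of_ne_zero hb⟩ h]
    simp only [degree_oreDiv, fracDegree]
    have hs : (s : F[X]) ≠ 0 := nonZeroDivisors.ne_zero s.2
    have hs' : (s' : F[X]) ≠ 0 := nonZeroDivisors.ne_zero s'.2
    by_cases hr' : r' = 0
    · simp [hr']
    by_cases hr : r = 0
    · have ha : a = 0 := by
        rw [hr, mul_zero] at h
        exact (mul_eq_zero.1 h.symm).resolve_right hs'
      simp [hr, ha]
    have ha : a ≠ 0 := by
      rintro rfl
      rw [zero_mul] at h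
      exact (mul_ne_zero hb hr) h
    have hd := congrArg natDegree h
    rw [natDegree_mul hb hr, natDegree_mul ha hs'] at hd
    simp only [mul_ne_zero ha hr', hr, hr', if_false, Submonoid.coe_mul]
    rw [← WithBot.coe_add, natDegree_mul ha hr', natDegree_mul hb hs]
    congr 1
    push_cast
    omega

/-- The degree as a homomorphism from the multiplicative group of `F(t)` to `ℤ`. -/
def degreeHom (F : Type*) [DivisionRing F] : (SkewRatFunc F)ˣ →* Multiplicative ℤ :=
  MonoidHom.mk' (fun u => Multiplicative.ofAdd ((degree (u : SkewRatFunc F)).unbot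
    (degree_ne_bot u.ne_zero))) (by
      intro u v
      rw [← ofAdd_add]
      congr 1
      rw [← WithBot.coe_inj]
      simp [degree_mul])

end SkewRatFunc

/-! ### The Dieudonné determinant over a skew field `K` -/

section Dieudonne

variable {K : Type*} [DivisionRing K]

/-- Lower triangular with all diagonal entries `1`. -/
def IsLowerUnitriangular {n : ℕ} (L : Matrix (Fin n) (Fin n) K) : Prop :=
  (∀ i, L i i = 1) ∧ ∀ i j, i < j → L i j = 0

/-- Upper triangular with all diagonal entries `1`. -/
def IsUpperUnitriangular {n : ℕ} (U : Matrix (Fin n) (Fin n) K) : Prop :=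
  (∀ i, U i i = 1) ∧ ∀ i j, j < i → U i j = 0

/-- `A = L D P U` is a Bruhat normal form of `A`, for some unitriangular `L` (lower) and `U`
(upper), with `D` the diagonal matrix with nonzero diagonal entries `d` and `P` the permutation
matrix of `σ`. -/
def IsBruhatForm {n : ℕ} (A : Matrix (Fin n) (Fin n) K) (d : Fin n → Kˣ)
    (σ : Equiv.Perm (Fin n)) : Prop :=
  ∃ L U : Matrix (Fin n) (Fin n) K, IsLowerUnitriangular L ∧ IsUpperUnitriangular U ∧
    A = L * Matrix.diagonal (fun i => (d i : K)) * σ.permMatrix K * U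

/-- The class of `sgn(P) d₁ d₂ ⋯ dₙ` in `Kˣ / [Kˣ, Kˣ]`. -/
def bruhatClass {n : ℕ} (d : Fin n → Kˣ) (σ : Equiv.Perm (Fin n)) : Abelianization Kˣ :=
  Abelianization.of
    (Units.map (Int.castRingHom K).toMonoidHom (Equiv.Perm.sign σ) * (List.ofFn d).prod)

open Classical in
/-- The Dieudonné determinant, with values in `Kˣ / [Kˣ, Kˣ]` for nonsingular matrices and the
value `0` for singular ones. A square matrix has a Bruhat normal form with nonzero diagonal
entries if and only if it is nonsingular, and `D P` (hence `d` and `σ`) is then unique. -/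
def dieudonneDet {n : ℕ} (A : Matrix (Fin n) (Fin n) K) : WithZero (Abelianization Kˣ) :=
  if h : ∃ x : (Fin n → Kˣ) × Equiv.Perm (Fin n), IsBruhatForm A x.1 x.2 then
    ((bruhatClass h.choose.1 h.choose.2 : Abelianization Kˣ) : WithZero (Abelianization Kˣ))
  else 0

end Dieudonne

namespace SkewRatFunc

variable {F : Type*} [DivisionRing F]

/-- `deg Det A`, which is `-∞` if `A` is singular. -/
def degDet {n : ℕ} (A : Matrix (Fin n) (Fin n) (SkewRatFunc F)) : WithBot ℤ :=
  WithZero.recZeroCoe (motive := fun _ => WithBot ℤ) ⊥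
    (fun c => ((Abelianization.lift (degreeHom F) c).toAdd : WithBot ℤ)) (dieudonneDet A)

/-- The set of the values `deg Det B` over all `k × k` submatrices `B` of `A`; a submatrix is
given by the increasing enumerations of its rows and of its columns. -/
def minorDegrees {n : ℕ} (A : Matrix (Fin n) (Fin n) (SkewRatFunc F)) (k : ℕ) :
    Set (WithBot ℤ) :=
  {d | ∃ f g : Fin k ↪o Fin n, d = degDet (A.submatrix f g)}

/-- A proper matrix: all entries have degree at most `0`. -/
def IsProper {n : ℕ} (A : Matrix (Fin n) (Fin n) (SkewRatFunc F)) : Prop :=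
  ∀ i j, degree (A i j) ≤ 0

/-- A biproper matrix: proper and nonsingular, with proper inverse. -/
def IsBiproper {n : ℕ} (A : Matrix (Fin n) (Fin n) (SkewRatFunc F)) : Prop :=
  IsProper A ∧ ∃ B : Matrix (Fin n) (Fin n) (SkewRatFunc F),
    A * B = 1 ∧ B * A = 1 ∧ IsProper B

/-- The diagonal matrix `(t^α)`. -/
def diagPow {n : ℕ} (α : Fin n → ℤ) : Matrix (Fin n) (Fin n) (SkewRatFunc F) :=
  Matrix.diagonal fun i => t F ^ α i

end SkewRatFunc

end

noncomputable section

namespace SkewRatFunc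

variable {F : Type*} [DivisionRing F]

theorem degree_zero : degree (0 : SkewRatFunc F) = ⊥ := by
  rw [← OreLocalization.zero_oreDiv (1 : F[X]⁰), degree_oreDiv]
  simp [fracDegree]

theorem degree_eq_bot {x : SkewRatFunc F} : degree x = ⊥ ↔ x = 0 :=
  ⟨fun h => by_contra fun hx => degree_ne_bot hx h, fun h => h ▸ degree_zero⟩

theorem degree_t : degree (t F) = 1 := by
  rw [t, OreLocalization.numeratorHom_apply, degree_oreDiv]
  simp [fracDegree]

theorem fracDegree_add_le (p q : F[X]) (u : F[X]⁰) :
    fracDegree (p + q) u ≤ max (fracDegree p u) (fracDegree q u) := by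
  by_cases hp : p = 0
  · rw [hp, zero_add]
    exact le_max_right _ _
  by_cases hq : q = 0
  · rw [hq, add_zero]
    exact le_max_left _ _
  simp only [fracDegree]
  by_cases hpq : p + q = 0
  · simp [hpq]
  simp only [hp, hq, hpq, if_false]
  rw [← WithBot.coe_max, WithBot.coe_le_coe]
  have := natDegree_add_le p q
  omega

theorem degree_add_le (x y : SkewRatFunc F) : degree (x + y) ≤ max (degree x) (degree y) := by
  induction x using OreLocalization.ind with
  | c r s =>
  induction y using OreLocalization.ind with
  | c r' s' =>
    obtain ⟨a, b, hb, h⟩ := Polynomial.exists_common_left_multiple (s : F[X]) (s' : F[X])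
      (nonZeroDivisors.ne_zero s'.2)
    have hs : (s : F[X]) ≠ 0 := nonZeroDivisors.ne_zero s.2
    have hbs : b * (s : F[X]) ∈ F[X]⁰ := mem_nonZeroDivisors_of_ne_zero (mul_ne_zero hb hs)
    have has : a * (s' : F[X]) ∈ F[X]⁰ := h ▸ hbs
    have e1 : (r /ₒ s : SkewRatFunc F) = (b * r) /ₒ ⟨b * (s : F[X]), hbs⟩ :=
      OreLocalization.expand r s b hbs
    have e2 : (r' /ₒ s' : SkewRatFunc F) = (a * r') /ₒ ⟨b * (s : F[X]), hbs⟩ := by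
      rw [OreLocalization.expand r' s' a has]
      simp only [h, smul_eq_mul]
    rw [e1, e2, OreLocalization.add_oreDiv]
    exact fracDegree_add_le _ _ _

theorem commute_t (x : SkewRatFunc F) : Commute (t F) x := by
  have hnum : ∀ p : F[X], Commute (t F) (OreLocalization.numeratorHom p : SkewRatFunc F) := by
    intro p
    rw [t, Commute, SemiconjBy, ← map_mul, ← map_mul, X_mul]
  induction x using OreLocalization.ind with
  | c r s =>
    have h : (r /ₒ s : SkewRatFunc F) =
        (OreLocalization.numeratorHom (s : F[X]) : SkewRatFunc F)⁻¹ *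
          OreLocalization.numeratorHom r := by
      have hs : (OreLocalization.numeratorHom (s : F[X]) : SkewRatFunc F) ≠ 0 :=
        (OreLocalization.numerator_isUnit s).ne_zero
      rw [eq_inv_mul_iff_mul_eq₀ hs]
      simp [OreLocalization.numeratorHom_apply, OreLocalization.mul_cancel]
    rw [h]
    exact ((hnum _).inv_right₀).mul_right (hnum r)

theorem degreeHom_apply {u : (SkewRatFunc F)ˣ} {m : ℤ}
    (h : degree (u : SkewRatFunc F) = m) : (degreeHom F u).toAdd = m := by
  rw [← WithBot.coe_inj, ← h]
  simp [degreeHom]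

end SkewRatFunc

/-! ### Degree functions on skew fields -/

/-- A degree function on a skew field, with values in `ℤ` and `-∞` at `0`, together with a central
element of degree `1`. -/
structure DegreeFunction (K : Type*) [DivisionRing K] where
  /-- The degree. -/
  deg : K → WithBot ℤ
  deg_eq_bot' : ∀ x, deg x = ⊥ ↔ x = 0
  deg_mul' : ∀ x y, deg (x * y) = deg x + deg y
  deg_add_le' : ∀ x y, deg (x + y) ≤ max (deg x) (deg y)
  /-- A central element of degree `1`. -/
  t : K
  deg_t : deg t = 1
  commute_t : ∀ x, Commute t x

/-- The degree function of `F(t)`. -/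
def SkewRatFunc.degreeFunction (F : Type*) [DivisionRing F] : DegreeFunction (SkewRatFunc F) where
  deg := SkewRatFunc.degree
  deg_eq_bot' _ := SkewRatFunc.degree_eq_bot
  deg_mul' := SkewRatFunc.degree_mul
  deg_add_le' := SkewRatFunc.degree_add_le
  t := SkewRatFunc.t F
  deg_t := SkewRatFunc.degree_t
  commute_t := SkewRatFunc.commute_t

namespace DegreeFunction

variable {K : Type*} [DivisionRing K] (v : DegreeFunction K)

theorem deg_eq_bot {x : K} : v.deg x = ⊥ ↔ x = 0 := v.deg_eq_bot' x

theorem deg_mul (x y : K) : v.deg (x * y) = v.deg x + v.deg y := v.deg_mul' x y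

theorem deg_add_le (x y : K) : v.deg (x + y) ≤ max (v.deg x) (v.deg y) := v.deg_add_le' x y

theorem deg_zero : v.deg 0 = ⊥ := v.deg_eq_bot.2 rfl

theorem exists_deg_eq {x : K} (hx : x ≠ 0) : ∃ m : ℤ, v.deg x = m :=
  (WithBot.ne_bot_iff_exists.1 (mt v.deg_eq_bot.1 hx)).imp fun _ h => h.symm

theorem ne_zero_of_deg {x : K} {m : ℤ} (h : v.deg x = m) : x ≠ 0 := by
  rintro rfl
  simp [deg_zero] at h

theorem deg_one : v.deg 1 = 0 := by
  obtain ⟨m, hm⟩ := v.exists_deg_eq (one_ne_zero (α := K))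
  have := v.deg_mul 1 1
  rw [one_mul, hm] at this
  rw [hm]
  norm_cast at this ⊢
  omega

theorem deg_neg (x : K) : v.deg (-x) = v.deg x := by
  have h1 : v.deg (-1) = 0 := by
    obtain ⟨m, hm⟩ := v.exists_deg_eq (neg_ne_zero.2 (one_ne_zero (α := K)))
    have := v.deg_mul (-1) (-1)
    rw [neg_mul_neg, one_mul, v.deg_one, hm] at this
    rw [hm]
    norm_cast at this ⊢
    omega
  rw [← neg_one_mul, v.deg_mul, h1, zero_add]

theorem deg_sub_le (x y : K) : v.deg (x - y) ≤ max (v.deg x) (v.deg y) := by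
  rw [sub_eq_add_neg, ← v.deg_neg y]
  exact v.deg_add_le _ _

theorem deg_sum_le {ι : Type*} (s : Finset ι) (f : ι → K) {d : WithBot ℤ}
    (h : ∀ i ∈ s, v.deg (f i) ≤ d) : v.deg (∑ i ∈ s, f i) ≤ d := by
  classical
  induction s using Finset.induction_on with
  | empty => simp [deg_zero]
  | insert a s ha ih =>
    rw [Finset.sum_insert ha]
    exact (v.deg_add_le _ _).trans (max_le (h a (by simp)) (ih fun i hi => h i (by simp [hi])))

theorem deg_inv {x : K} {m : ℤ} (hx : v.deg x = m) : v.deg x⁻¹ = ((-m : ℤ) : WithBot ℤ) := by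
  have h0 := v.ne_zero_of_deg hx
  obtain ⟨k, hk⟩ := v.exists_deg_eq (inv_ne_zero h0)
  have := v.deg_mul x x⁻¹
  rw [mul_inv_cancel₀ h0, v.deg_one, hx, hk] at this
  rw [hk]
  norm_cast at this ⊢
  omega

theorem t_ne_zero : v.t ≠ 0 := v.ne_zero_of_deg (m := 1) v.deg_t

theorem deg_t_zpow (m : ℤ) : v.deg (v.t ^ m) = m := by
  have key : ∀ k : ℕ, v.deg (v.t ^ k) = ((k : ℤ) : WithBot ℤ) := by
    intro k
    induction k with
    | zero => simp [deg_one]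
    | succ k ih => rw [pow_succ, v.deg_mul, ih, v.deg_t]; push_cast; rfl
  cases m with
  | ofNat k => simpa using key k
  | negSucc k => rw [zpow_negSucc, v.deg_inv (key (k + 1))]; rfl

theorem commute_t_zpow (m : ℤ) (x : K) : Commute (v.t ^ m) x :=
  (v.commute_t x).zpow_left₀ m

/-- The valuation ring: the elements of degree at most `0`. -/
def integers : Subring K where
  carrier := {x | v.deg x ≤ 0}
  mul_mem' {x y} hx hy := by
    rw [Set.mem_ofPred_eq, v.deg_mul]
    exact add_nonpos hx hy
  one_mem' := v.deg_one.le
  add_mem' {x y} hx hy := (v.deg_add_le x y).trans (max_le hx hy)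
  zero_mem' := by simp [deg_zero]
  neg_mem' {x} hx := by rwa [Set.mem_ofPred_eq, v.deg_neg]

theorem mem_integers {x : K} : x ∈ v.integers ↔ v.deg x ≤ 0 := Iff.rfl

end DegreeFunction

/-! ### Lengths of cokernels -/

section Coker

variable {R M : Type*} [Ring R] [AddCommGroup M] [Module R M]

theorem length_quotient_range_comp (f g : M →ₗ[R] M) (hg : Function.Injective g) :
    Module.length R (M ⧸ LinearMap.range (g ∘ₗ f)) =
      Module.length R (M ⧸ LinearMap.range f) + Module.length R (M ⧸ LinearMap.range g) := by
  have h1 : LinearMap.range f ≤ (LinearMap.range (g ∘ₗ f)).comap g := by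
    rintro _ ⟨x, rfl⟩
    exact ⟨x, rfl⟩
  have h2 : LinearMap.range (g ∘ₗ f) ≤ LinearMap.range g := LinearMap.range_comp_le_range f g
  refine Module.length_eq_add_of_exact (Submodule.mapQ _ _ g h1) (Submodule.factor h2) ?_ ?_ ?_
  · rw [← LinearMap.ker_eq_bot, LinearMap.ker_eq_bot']
    intro x hx
    induction x using Submodule.Quotient.induction_on with
    | H x =>
      rw [Submodule.mapQ_apply, Submodule.Quotient.mk_eq_zero] at hx
      obtain ⟨y, hy⟩ := hx
      rw [Submodule.Quotient.mk_eq_zero]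
      exact ⟨y, hg hy⟩
  · exact Submodule.factor_surjective h2
  · intro x
    induction x using Submodule.Quotient.induction_on with
    | H x =>
      constructor
      · intro hx
        rw [Submodule.factor, Submodule.mapQ_apply, Submodule.Quotient.mk_eq_zero] at hx
        obtain ⟨y, rfl⟩ := hx
        exact ⟨Submodule.Quotient.mk y, rfl⟩
      · rintro ⟨y, hy⟩
        induction y using Submodule.Quotient.induction_on with
        | H y =>
          rw [← hy, Submodule.mapQ_apply, Submodule.factor, Submodule.mapQ_apply,
            Submodule.Quotient.mk_eq_zero]
          exact ⟨y, rfl⟩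

end Coker

section CokerLength

variable {R : Type*} [Ring R] {k : ℕ}

/-- The length of the cokernel of a square matrix acting on row vectors. -/
def Matrix.cokerLength (A : Matrix (Fin k) (Fin k) R) : ℕ∞ :=
  Module.length R ((Fin k → R) ⧸ LinearMap.range A.toLinearMapRight')

theorem Matrix.cokerLength_mul (A B : Matrix (Fin k) (Fin k) R)
    (hB : Function.Injective fun x => Matrix.vecMul x B) :
    (A * B).cokerLength = A.cokerLength + B.cokerLength := by
  rw [cokerLength, Matrix.toLinearMapRight'_mul]
  exact length_quotient_range_comp _ _ hB

theorem Matrix.cokerLength_diagonal (d : Fin k → R) :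
    (Matrix.diagonal d).cokerLength =
      ∑ i, Module.length R (R ⧸ LinearMap.range (LinearMap.toSpanSingleton R R (d i))) := by
  let q : (Fin k → R) →ₗ[R] ∀ i, R ⧸ LinearMap.range (LinearMap.toSpanSingleton R R (d i)) :=
    LinearMap.pi fun i => (Submodule.mkQ _).comp (LinearMap.proj i)
  have hq : Function.Surjective q := by
    intro y
    choose x hx using fun i => Submodule.mkQ_surjective _ (y i)
    exact ⟨x, funext hx⟩
  have h : LinearMap.range (Matrix.diagonal d).toLinearMapRight' = LinearMap.ker q := by
    ext x
    rw [LinearMap.mem_ker, funext_iff]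
    simp only [q, LinearMap.pi_apply, LinearMap.comp_apply, LinearMap.proj_apply,
      Submodule.mkQ_apply, Pi.zero_apply, Submodule.Quotient.mk_eq_zero, LinearMap.mem_range,
      Matrix.toLinearMapRight'_apply, LinearMap.toSpanSingleton_apply, smul_eq_mul]
    constructor
    · rintro ⟨y, rfl⟩ i
      exact ⟨y i, (Matrix.vecMul_diagonal _ _ _).symm⟩
    · intro h
      choose y hy using h
      exact ⟨y, funext fun i => (Matrix.vecMul_diagonal _ _ _).trans (hy i)⟩
  rw [cokerLength, h, (LinearMap.quotKerEquivOfSurjective q hq).length_eq,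
    Module.length_pi_of_fintype]

end CokerLength

namespace DegreeFunction

variable {K : Type*} [DivisionRing K] (v : DegreeFunction K)

theorem length_quotient_toSpanSingleton (m : ℕ) (d : v.integers)
    (hd : v.deg d = ((-m : ℤ) : WithBot ℤ)) :
    Module.length v.integers
      (v.integers ⧸ LinearMap.range (LinearMap.toSpanSingleton v.integers v.integers d)) = m := by
  have hunit : ∀ x : v.integers, v.deg x = 0 → ∃ y : v.integers, y * x = 1 := by
    intro x hx
    have hx' : v.deg (x : K) = ((0 : ℤ) : WithBot ℤ) := hx
    refine ⟨⟨(x : K)⁻¹, ?_⟩, Subtype.ext (inv_mul_cancel₀ (v.ne_zero_of_deg hx'))⟩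
    rw [mem_integers, v.deg_inv hx']
    simp
  have hπ : v.t⁻¹ ∈ v.integers := by
    rw [mem_integers, v.deg_inv (m := 1) v.deg_t]
    exact WithBot.coe_le_coe.2 (by norm_num)
  have hone : Module.length v.integers (v.integers ⧸
      LinearMap.range (LinearMap.toSpanSingleton v.integers v.integers ⟨v.t⁻¹, hπ⟩)) = 1 := by
    rw [Module.length_eq_one_iff, isSimpleModule_iff_isCoatom]
    constructor
    · intro h
      have h1 : (1 : v.integers) ∈ (⊤ : Submodule v.integers v.integers) := trivial
      rw [← h] at h1
      obtain ⟨y, hy⟩ := h1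
      have h2 := congrArg (fun z : v.integers => v.deg z) hy
      have h3 := y.2
      simp only [LinearMap.toSpanSingleton_apply, smul_eq_mul, Subring.coe_mul, v.deg_mul,
        Subring.coe_one, v.deg_one, v.deg_inv (m := 1) v.deg_t] at h2
      rw [mem_integers] at h3
      cases hh : v.deg (y : K) with
      | bot => rw [hh] at h2; simp at h2
      | coe a =>
        rw [hh] at h2 h3
        norm_cast at h2 h3
        omega
    · intro I hI
      obtain ⟨x, hxI, hx⟩ := SetLike.exists_of_lt hI
      have hx0 : v.deg (x : K) = 0 := by
        by_contra hne
        refine hx ⟨⟨(x : K) * v.t, ?_⟩, Subtype.ext ?_⟩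
        · have h3 := x.2
          rw [mem_integers] at h3 ⊢
          rw [v.deg_mul, v.deg_t]
          cases hh : v.deg (x : K) with
          | bot => simp
          | coe a =>
            rw [hh] at h3 hne
            norm_cast at h3 hne ⊢
            omega
        · simp [v.t_ne_zero]
      obtain ⟨y, hy⟩ := hunit x hx0
      rw [Ideal.eq_top_iff_one I, ← hy]
      exact I.smul_mem y hxI
  induction m generalizing d with
  | zero =>
    rw [Nat.cast_zero, Module.length_eq_zero_iff, Submodule.Quotient.subsingleton_iff]
    obtain ⟨y, hy⟩ := hunit d (by simpa using hd)
    rw [eq_top_iff]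
    rintro x -
    exact ⟨x * y, by simp [mul_assoc, hy]⟩
  | succ m ih =>
    have hc : v.deg ((d : K) * v.t) = ((-m : ℤ) : WithBot ℤ) := by
      rw [v.deg_mul, hd, v.deg_t, ← WithBot.coe_one, ← WithBot.coe_add]
      congr 1
      push_cast
      ring
    have hc' : (d : K) * v.t ∈ v.integers := by
      rw [mem_integers, hc]
      exact WithBot.coe_le_coe.2 (by simp)
    have hcomp : LinearMap.toSpanSingleton v.integers v.integers d =
        LinearMap.toSpanSingleton v.integers v.integers ⟨v.t⁻¹, hπ⟩ ∘ₗ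
          LinearMap.toSpanSingleton v.integers v.integers ⟨(d : K) * v.t, hc'⟩ := by
      ext
      simp [v.t_ne_zero]
    rw [hcomp, length_quotient_range_comp, hone, ih _ hc]
    · simp
    · intro x y hxy
      have := congrArg Subtype.val hxy
      simpa [v.t_ne_zero] using this

variable {k : ℕ}

/-- A proper matrix: all entries have degree at most `0`. -/
def IsProper {m n : Type*} (A : Matrix m n K) : Prop := ∀ i j, v.deg (A i j) ≤ 0

theorem exists_deg_le {m n : Type*} [Finite m] [Finite n] (A : Matrix m n K) :
    ∃ N : ℕ, ∀ i j, v.deg (A i j) ≤ ((N : ℤ) : WithBot ℤ) := by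
  have h : ∀ p : m × n, ∃ N : ℕ, v.deg (A p.1 p.2) ≤ ((N : ℤ) : WithBot ℤ) := by
    intro p
    cases hh : v.deg (A p.1 p.2) with
    | bot => exact ⟨0, bot_le⟩
    | coe a => exact ⟨a.toNat, WithBot.coe_le_coe.2 a.self_le_toNat⟩
  choose N hN using h
  obtain ⟨M, hM⟩ := (Set.finite_range N).bddAbove
  exact ⟨M, fun i j => (hN (i, j)).trans
    (WithBot.coe_le_coe.2 (Int.ofNat_le.2 (hM ⟨(i, j), rfl⟩)))⟩

theorem exists_mapMatrix_eq {A : Matrix (Fin k) (Fin k) K} (hA : v.IsProper A) :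
    ∃ B : Matrix (Fin k) (Fin k) v.integers, v.integers.subtype.mapMatrix B = A :=
  ⟨fun i j => ⟨A i j, hA i j⟩, rfl⟩

theorem mapMatrix_injective :
    Function.Injective (v.integers.subtype.mapMatrix (m := Fin k)) :=
  Matrix.map_injective Subtype.val_injective

theorem vecMul_injective {A : Matrix (Fin k) (Fin k) v.integers}
    (hA : IsUnit (v.integers.subtype.mapMatrix A)) :
    Function.Injective fun x => Matrix.vecMul x A := by
  intro x y hxy
  obtain ⟨u, hu⟩ := hA
  have h : Matrix.vecMul (v.integers.subtype ∘ x) (u : Matrix (Fin k) (Fin k) K) =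
      Matrix.vecMul (v.integers.subtype ∘ y) (u : Matrix (Fin k) (Fin k) K) := by
    ext i
    have h1 := congrArg v.integers.subtype (congrFun hxy i)
    rwa [RingHom.map_vecMul, RingHom.map_vecMul, ← RingHom.mapMatrix_apply, ← hu] at h1
  have h2 := congrArg (fun z => Matrix.vecMul z (↑u⁻¹ : Matrix (Fin k) (Fin k) K)) h
  simp only [Matrix.vecMul_vecMul, Units.mul_inv, Matrix.vecMul_one] at h2
  exact funext fun i => Subtype.ext (congrFun h2 i)

/-- `v.tScalar N` is the scalar matrix `t⁻ᴺ` over the valuation ring. -/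
def tScalar (k N : ℕ) : Matrix (Fin k) (Fin k) v.integers :=
  Matrix.diagonal fun _ => ⟨v.t ^ (-N : ℤ), by
    rw [mem_integers, v.deg_t_zpow]
    exact WithBot.coe_le_coe.2 (by simp)⟩

theorem mapMatrix_tScalar (N : ℕ) :
    v.integers.subtype.mapMatrix (v.tScalar k N) = v.t ^ (-N : ℤ) • 1 := by
  rw [RingHom.mapMatrix_apply, tScalar, Matrix.diagonal_map (map_zero _), ← Matrix.diagonal_one,
    ← Matrix.diagonal_smul]
  congr 1
  ext i
  simp

theorem cokerLength_tScalar (N : ℕ) : (v.tScalar k N).cokerLength = ((N * k : ℕ) : ℕ∞) := by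
  rw [tScalar, Matrix.cokerLength_diagonal]
  rw [Finset.sum_congr rfl fun i _ => v.length_quotient_toSpanSingleton N _ (v.deg_t_zpow _)]
  simp [mul_comm]

theorem mul_t_smul (m : ℤ) (A B : Matrix (Fin k) (Fin k) K) :
    A * (v.t ^ m • B) = v.t ^ m • (A * B) := by
  ext i j
  simp only [Matrix.mul_apply, Matrix.smul_apply, smul_eq_mul, Finset.mul_sum]
  exact Finset.sum_congr rfl fun l _ => by
    rw [← mul_assoc, ← mul_assoc, (v.commute_t_zpow m (A i l)).eq]

theorem isUnit_t_smul (m : ℤ) {A : Matrix (Fin k) (Fin k) K} (hA : IsUnit A) :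
    IsUnit (v.t ^ m • A) := by
  obtain ⟨u, rfl⟩ := hA
  refine IsUnit.of_mul_eq_one (v.t ^ (-m) • (↑u⁻¹ : Matrix (Fin k) (Fin k) K)) ?_
  rw [mul_t_smul, Matrix.smul_mul, Units.mul_inv, smul_smul, ← zpow_add₀ v.t_ne_zero]
  simp

/-- The nonsingular matrix `X` has determinant of degree `z`: for a proper multiple `t⁻ᴺ X`,
the length of its cokernel is `N k - z`. -/
def HasDetDeg (X : Matrix (Fin k) (Fin k) K) (z : ℤ) : Prop :=
  IsUnit X ∧ ∃ (N m : ℕ) (A : Matrix (Fin k) (Fin k) v.integers),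
    v.integers.subtype.mapMatrix A = v.t ^ (-N : ℤ) • X ∧ A.cokerLength = m ∧
      z = ((N * k : ℕ) : ℤ) - m

variable {v}

theorem HasDetDeg.unique {X : Matrix (Fin k) (Fin k) K} {z z' : ℤ} (h : v.HasDetDeg X z)
    (h' : v.HasDetDeg X z') : z = z' := by
  obtain ⟨hX, N, m, A, hA, hm, rfl⟩ := h
  obtain ⟨-, N', m', A', hA', hm', rfl⟩ := h'
  have key : v.tScalar k N' * A = v.tScalar k N * A' := by
    apply v.mapMatrix_injective
    rw [map_mul, map_mul, mapMatrix_tScalar, mapMatrix_tScalar, hA, hA', Matrix.smul_mul,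
      Matrix.smul_mul, one_mul, one_mul, smul_smul, smul_smul, ← zpow_add₀ v.t_ne_zero,
      ← zpow_add₀ v.t_ne_zero, add_comm]
  have := congrArg Matrix.cokerLength key
  rw [Matrix.cokerLength_mul, Matrix.cokerLength_mul, cokerLength_tScalar, cokerLength_tScalar,
    hm, hm'] at this
  · norm_cast at this
    omega
  · exact v.vecMul_injective (hA' ▸ v.isUnit_t_smul _ hX)
  · exact v.vecMul_injective (hA ▸ v.isUnit_t_smul _ hX)

theorem HasDetDeg.mul {X Y : Matrix (Fin k) (Fin k) K} {x y : ℤ} (hX : v.HasDetDeg X x)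
    (hY : v.HasDetDeg Y y) : v.HasDetDeg (X * Y) (x + y) := by
  obtain ⟨hX, N, m, A, hA, hm, rfl⟩ := hX
  obtain ⟨hY, M, l, B, hB, hl, rfl⟩ := hY
  refine ⟨hX.mul hY, N + M, m + l, A * B, ?_, ?_, ?_⟩
  · rw [map_mul, hA, hB, mul_t_smul, Matrix.smul_mul, smul_smul, ← zpow_add₀ v.t_ne_zero]
    congr 2
    push_cast
    ring
  · rw [Matrix.cokerLength_mul _ _ (v.vecMul_injective (hB ▸ v.isUnit_t_smul _ hY)), hm, hl,
      Nat.cast_add]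
  · push_cast
    ring

variable (v)

theorem exists_hasDetDeg {X : Matrix (Fin k) (Fin k) K} (hX : IsUnit X) :
    ∃ z, v.HasDetDeg X z := by
  have hproper : ∀ Y : Matrix (Fin k) (Fin k) K, ∃ (N : ℕ)
      (A : Matrix (Fin k) (Fin k) v.integers),
      v.integers.subtype.mapMatrix A = v.t ^ (-N : ℤ) • Y := by
    intro Y
    obtain ⟨N, hN⟩ := v.exists_deg_le Y
    obtain ⟨A, hA⟩ := v.exists_mapMatrix_eq (A := v.t ^ (-N : ℤ) • Y) (by
      intro i j
      rw [Matrix.smul_apply, smul_eq_mul, v.deg_mul, v.deg_t_zpow]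
      refine (add_le_add_right (hN i j) _).trans ?_
      rw [← WithBot.coe_add]
      simp)
    exact ⟨N, A, hA⟩
  obtain ⟨u, rfl⟩ := hX
  obtain ⟨N, A, hA⟩ := hproper u
  obtain ⟨M, B, hB⟩ := hproper (↑u⁻¹ : Matrix (Fin k) (Fin k) K)
  have hAB : A * B = v.tScalar k (N + M) := by
    apply v.mapMatrix_injective
    rw [map_mul, hA, hB, mapMatrix_tScalar, mul_t_smul, Matrix.smul_mul, Units.mul_inv,
      smul_smul, ← zpow_add₀ v.t_ne_zero]
    congr 2
    push_cast
    ring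
  have hlen := congrArg Matrix.cokerLength hAB
  rw [Matrix.cokerLength_mul _ _ (v.vecMul_injective (hB ▸ v.isUnit_t_smul _ u⁻¹.isUnit)),
    cokerLength_tScalar] at hlen
  have hfin : A.cokerLength ≠ ⊤ := by
    intro h
    rw [h, top_add] at hlen
    exact ENat.natCast_ne_top _ hlen.symm
  obtain ⟨m, hm⟩ := ENat.ne_top_iff_exists.1 hfin
  exact ⟨_, u.isUnit, N, m, A, hA, hm.symm, rfl⟩

variable {v} in
theorem HasDetDeg.nonpos {X : Matrix (Fin k) (Fin k) K} {z : ℤ} (h : v.HasDetDeg X z)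
    (hX : v.IsProper X) : z ≤ 0 := by
  obtain ⟨A, hA⟩ := v.exists_mapMatrix_eq hX
  obtain ⟨hu, N, m, B, hB, hm, rfl⟩ := h
  have hBA : B = v.tScalar k N * A := by
    apply v.mapMatrix_injective
    rw [hB, map_mul, mapMatrix_tScalar, hA, Matrix.smul_mul, one_mul]
  rw [hBA, Matrix.cokerLength_mul _ _ (v.vecMul_injective (hA ▸ hu)), cokerLength_tScalar] at hm
  have : ((N * k : ℕ) : ℕ∞) ≤ m := hm ▸ le_self_add
  have := Nat.cast_le.1 this
  omega

theorem hasDetDeg_diagonal {d : Fin k → K} {z : Fin k → ℤ} (hd : ∀ i, v.deg (d i) = z i) :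
    v.HasDetDeg (Matrix.diagonal d) (∑ i, z i) := by
  obtain ⟨N, hN⟩ : ∃ N : ℕ, ∀ i, z i ≤ N := by
    obtain ⟨M, hM⟩ := (Set.finite_range z).bddAbove
    exact ⟨M.toNat, fun i => (hM ⟨i, rfl⟩).trans M.self_le_toNat⟩
  have hdeg : ∀ i, v.deg (v.t ^ (-N : ℤ) * d i) =
      ((-((N - z i).toNat : ℕ) : ℤ) : WithBot ℤ) := by
    intro i
    have := hN i
    rw [v.deg_mul, v.deg_t_zpow, hd, ← WithBot.coe_add]
    congr 1
    omega
  have hmem : ∀ i, v.t ^ (-N : ℤ) * d i ∈ v.integers := by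
    intro i
    rw [mem_integers, hdeg]
    exact WithBot.coe_le_coe.2 (by simp)
  refine ⟨?_, N, ∑ i, (N - z i).toNat, Matrix.diagonal fun i => ⟨_, hmem i⟩, ?_, ?_, ?_⟩
  · refine IsUnit.of_mul_eq_one (Matrix.diagonal fun i => (d i)⁻¹) ?_
    rw [Matrix.diagonal_mul_diagonal, ← Matrix.diagonal_one]
    congr 1
    ext i
    exact mul_inv_cancel₀ (v.ne_zero_of_deg (hd i))
  · rw [RingHom.mapMatrix_apply, Matrix.diagonal_map (map_zero _), ← Matrix.diagonal_smul]
    rfl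
  · rw [Matrix.cokerLength_diagonal, Nat.cast_sum]
    exact Finset.sum_congr rfl fun i _ => v.length_quotient_toSpanSingleton _ _ (hdeg i)
  · have : ∀ i, (((N - z i).toNat : ℕ) : ℤ) = N - z i := fun i => Int.toNat_of_nonneg (by
      have := hN i
      omega)
    push_cast
    simp only [this, Finset.sum_sub_distrib]
    simp
    ring

end DegreeFunction

namespace DegreeFunction

variable {K : Type*} [DivisionRing K] (v : DegreeFunction K) {k : ℕ}

open Classical in
/-- The degree of the Dieudonné determinant, and `-∞` for singular matrices. -/
def detDeg (X : Matrix (Fin k) (Fin k) K) : WithBot ℤ :=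
  if h : IsUnit X then ((v.exists_hasDetDeg h).choose : WithBot ℤ) else ⊥

variable {v} in
theorem HasDetDeg.detDeg_eq {X : Matrix (Fin k) (Fin k) K} {z : ℤ} (h : v.HasDetDeg X z) :
    v.detDeg X = z := by
  rw [detDeg, dif_pos h.1, (v.exists_hasDetDeg h.1).choose_spec.unique h]

theorem detDeg_of_not_isUnit {X : Matrix (Fin k) (Fin k) K} (h : ¬IsUnit X) :
    v.detDeg X = ⊥ := dif_neg h

theorem detDeg_mul (X Y : Matrix (Fin k) (Fin k) K) :
    v.detDeg (X * Y) = v.detDeg X + v.detDeg Y := by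
  by_cases hX : IsUnit X
  · by_cases hY : IsUnit Y
    · obtain ⟨x, hx⟩ := v.exists_hasDetDeg hX
      obtain ⟨y, hy⟩ := v.exists_hasDetDeg hY
      rw [hx.detDeg_eq, hy.detDeg_eq, (hx.mul hy).detDeg_eq, WithBot.coe_add]
    · rw [v.detDeg_of_not_isUnit hY, WithBot.add_bot, v.detDeg_of_not_isUnit]
      exact fun h => hY (isUnit_of_mul_isUnit_right h)
  · rw [v.detDeg_of_not_isUnit hX, WithBot.bot_add, v.detDeg_of_not_isUnit]
    exact fun h => hX (isUnit_of_mul_isUnit_left h)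

theorem detDeg_diagonal (d : Fin k → K) :
    v.detDeg (Matrix.diagonal d) = ∑ i, v.deg (d i) := by
  by_cases h : ∀ i, d i ≠ 0
  · choose z hz using fun i => v.exists_deg_eq (h i)
    rw [(v.hasDetDeg_diagonal hz).detDeg_eq, WithBot.coe_sum]
    exact Finset.sum_congr rfl fun i _ => (hz i).symm
  · push Not at h
    obtain ⟨i, hi⟩ := h
    rw [v.detDeg_of_not_isUnit, eq_comm, WithBot.sum_eq_bot_iff]
    · exact ⟨i, Finset.mem_univ i, v.deg_eq_bot.2 hi⟩
    · intro hu
      obtain ⟨B, hB, -⟩ := isUnit_iff_exists.1 hu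
      have := congrFun (congrFun hB i) i
      simp [Matrix.diagonal_mul, hi] at this

/-- A biproper matrix: proper and nonsingular, with proper inverse. -/
def IsBiproper (A : Matrix (Fin k) (Fin k) K) : Prop :=
  v.IsProper A ∧ ∃ B : Matrix (Fin k) (Fin k) K, A * B = 1 ∧ B * A = 1 ∧ v.IsProper B

theorem detDeg_one : v.detDeg (1 : Matrix (Fin k) (Fin k) K) = 0 := by
  rw [← Matrix.diagonal_one, v.detDeg_diagonal]
  simp [deg_one]

variable {v} in
theorem IsBiproper.detDeg_eq {A : Matrix (Fin k) (Fin k) K} (h : v.IsBiproper A) :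
    v.detDeg A = 0 := by
  obtain ⟨hA, B, h1, h2, hB⟩ := h
  obtain ⟨a, ha⟩ := v.exists_hasDetDeg (isUnit_iff_exists.2 ⟨B, h1, h2⟩)
  obtain ⟨b, hb⟩ := v.exists_hasDetDeg (isUnit_iff_exists.2 ⟨A, h2, h1⟩)
  have := v.detDeg_mul A B
  rw [h1, v.detDeg_one, ha.detDeg_eq, hb.detDeg_eq] at this
  have ha' := ha.nonpos hA
  have hb' := hb.nonpos hB
  rw [ha.detDeg_eq]
  norm_cast at this ⊢
  omega

theorem isProper_one : v.IsProper (1 : Matrix (Fin k) (Fin k) K) := by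
  intro i j
  rw [Matrix.one_apply]
  split_ifs
  · exact v.deg_one.le
  · simp [deg_zero]

theorem isProper_mul {l m n : Type*} [Fintype m] {A : Matrix l m K} {B : Matrix m n K}
    (hA : v.IsProper A) (hB : v.IsProper B) : v.IsProper (A * B) := fun i j =>
  v.deg_sum_le _ _ fun c _ => (v.deg_mul _ _).trans_le (add_nonpos (hA i c) (hB c j))

theorem isBiproper_one : v.IsBiproper (1 : Matrix (Fin k) (Fin k) K) :=
  ⟨v.isProper_one, 1, one_mul 1, one_mul 1, v.isProper_one⟩

variable {v} in
theorem IsBiproper.mul {A B : Matrix (Fin k) (Fin k) K} (hA : v.IsBiproper A)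
    (hB : v.IsBiproper B) : v.IsBiproper (A * B) := by
  obtain ⟨hA, A', hA1, hA2, hA'⟩ := hA
  obtain ⟨hB, B', hB1, hB2, hB'⟩ := hB
  refine ⟨v.isProper_mul hA hB, B' * A', ?_, ?_, v.isProper_mul hB' hA'⟩
  · rw [mul_assoc, ← mul_assoc B, hB1, one_mul, hA1]
  · rw [mul_assoc, ← mul_assoc A', hA2, one_mul, hB2]

theorem isBiproper_permMatrix (σ : Equiv.Perm (Fin k)) : v.IsBiproper (σ.permMatrix K) := by
  have h : ∀ τ : Equiv.Perm (Fin k), v.IsProper (τ.permMatrix K) := by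
    intro τ i j
    rw [Equiv.Perm.permMatrix, PEquiv.toMatrix_apply]
    split_ifs
    · exact v.deg_one.le
    · simp [deg_zero]
  refine ⟨h σ, σ⁻¹.permMatrix K, ?_, ?_, h _⟩
  · rw [← Matrix.permMatrix_mul, inv_mul_cancel, Matrix.permMatrix_one]
  · rw [← Matrix.permMatrix_mul, mul_inv_cancel, Matrix.permMatrix_one]

end DegreeFunction

/-- `1 + u w` and `1 - u w` are inverse to each other if `w u = 0`. -/
theorem Matrix.one_add_vecMulVec_mul {R : Type*} [Ring R] {k : ℕ} {u w : Fin k → R}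
    (h : w ⬝ᵥ u = 0) :
    (1 + Matrix.vecMulVec u w) * (1 + Matrix.vecMulVec (-u) w) = 1 := by
  have : vecMulVec u w * vecMulVec u w = 0 := by
    ext i j
    simp only [Matrix.mul_apply, Matrix.vecMulVec_apply, Matrix.zero_apply]
    have : ∀ x, u i * w x * (u x * w j) = u i * (w x * u x) * w j := fun x => by
      simp only [mul_assoc]
    simp only [this, ← Finset.mul_sum, ← Finset.sum_mul]
    rw [dotProduct] at h
    rw [h, mul_zero, zero_mul]
  rw [Matrix.neg_vecMulVec, mul_add, mul_one, mul_neg, add_mul, this]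
  simp

namespace DegreeFunction

variable {K : Type*} [DivisionRing K] (v : DegreeFunction K) {k : ℕ}

theorem isBiproper_one_add_vecMulVec {u w : Fin k → K} (h : w ⬝ᵥ u = 0)
    (hp : ∀ i j, v.deg (u i * w j) ≤ 0) : v.IsBiproper (1 + Matrix.vecMulVec u w) := by
  have key : ∀ u' : Fin k → K, (∀ i j, v.deg (u' i * w j) ≤ 0) →
      v.IsProper (1 + Matrix.vecMulVec u' w) := fun u' hu' i j =>
    (v.deg_add_le _ _).trans (max_le (v.isProper_one i j) (hu' i j))
  have h' : w ⬝ᵥ (-u) = 0 := by rw [dotProduct_neg, h, neg_zero]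
  refine ⟨key u hp, 1 + Matrix.vecMulVec (-u) w, Matrix.one_add_vecMulVec_mul h, ?_,
    key _ fun i j => ?_⟩
  · simpa using Matrix.one_add_vecMulVec_mul h'
  · rw [Pi.neg_apply, neg_mul, v.deg_neg]
    exact hp i j

theorem detDeg_one_add_vecMulVec (e : Fin k → ℤ) {u w : Fin k → K} (h : w ⬝ᵥ u = 0)
    (hp : ∀ i j, v.deg (u i * w j) ≤ ((e j - e i : ℤ) : WithBot ℤ)) :
    v.detDeg (1 + Matrix.vecMulVec u w) = 0 := by
  set D := Matrix.diagonal fun i => v.t ^ e i with hD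
  set D' := Matrix.diagonal fun i => v.t ^ (-e i) with hD'
  have hDD : D * D' = 1 := by
    rw [hD, hD', Matrix.diagonal_mul_diagonal, ← Matrix.diagonal_one]
    congr 1
    ext i
    rw [← zpow_add₀ v.t_ne_zero]
    simp
  have hconj : D * (1 + Matrix.vecMulVec u w) * D' =
      1 + Matrix.vecMulVec (fun i => v.t ^ e i * u i) (fun j => w j * v.t ^ (-e j)) := by
    rw [mul_add, add_mul, mul_one, hDD]
    congr 1
    ext i j
    simp [hD, hD', Matrix.vecMulVec_apply, mul_assoc]
  have hbi := v.isBiproper_one_add_vecMulVec (u := fun i => v.t ^ e i * u i)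
    (w := fun j => w j * v.t ^ (-e j)) (by
      rw [← h]
      refine Finset.sum_congr rfl fun i _ => ?_
      rw [mul_assoc, ← mul_assoc (v.t ^ (-e i)), ← zpow_add₀ v.t_ne_zero]
      simp) (by
      intro i j
      rw [mul_assoc, ← mul_assoc (u i), v.deg_mul, v.deg_mul, v.deg_t_zpow, v.deg_t_zpow]
      refine (add_le_add le_rfl (add_le_add (hp i j) le_rfl)).trans ?_
      rw [← WithBot.coe_add, ← WithBot.coe_add, ← WithBot.coe_zero, WithBot.coe_le_coe]
      omega)
  have h1 := hbi.detDeg_eq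
  have h2 := v.detDeg_mul D D'
  rw [hDD, v.detDeg_one] at h2
  rw [← hconj, v.detDeg_mul, v.detDeg_mul, add_right_comm, ← h2, zero_add] at h1
  exact h1

theorem detDeg_one_add_vecMulVec_single_right (s : Fin k) {u : Fin k → K} (hu : u s = 0) :
    v.detDeg (1 + Matrix.vecMulVec u (Pi.single s 1)) = 0 := by
  obtain ⟨N, hN⟩ := v.exists_deg_le (Matrix.of fun (i : Fin k) (_ : Unit) => u i)
  refine v.detDeg_one_add_vecMulVec (Pi.single s N) (by simp [hu]) fun i j => ?_
  by_cases hj : j = s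
  · subst hj
    by_cases hi : i = j
    · simp [hi, hu, deg_zero]
    · simpa [hi] using hN i ()
  · simp [hj, deg_zero]

theorem detDeg_one_add_vecMulVec_single_left (s : Fin k) {w : Fin k → K} (hw : w s = 0) :
    v.detDeg (1 + Matrix.vecMulVec (Pi.single s 1) w) = 0 := by
  obtain ⟨N, hN⟩ := v.exists_deg_le (Matrix.of fun (i : Fin k) (_ : Unit) => w i)
  refine v.detDeg_one_add_vecMulVec (-Pi.single s (N : ℤ)) (by simp [hw]) fun i j => ?_
  by_cases hi : i = s
  · subst hi
    by_cases hj : j = i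
    · simp [hj, hw, deg_zero]
    · simpa [hj] using hN j ()
  · simp [hi, deg_zero]

/-- A unitriangular matrix, with respect to an arbitrary ordering of the indices, has determinant
of degree `0`. -/
theorem detDeg_unitriangular (r : Fin k → ℕ) (hr : Function.Injective r)
    {M : Matrix (Fin k) (Fin k) K} (h1 : ∀ i, M i i = 1)
    (h0 : ∀ i j, i ≠ j → r i ≤ r j → M i j = 0) : v.detDeg M = 0 := by
  suffices H : ∀ (s : ℕ) (M : Matrix (Fin k) (Fin k) K), (∀ i, M i i = 1) →
      (∀ i j, i ≠ j → r i ≤ r j → M i j = 0) → (∀ i j, i ≠ j → s ≤ r j → M i j = 0) →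
      v.detDeg M = 0 by
    obtain ⟨s, hs⟩ := (Set.finite_range r).bddAbove
    refine H (s + 1) M h1 h0 fun i j _ hj => ?_
    have := hs ⟨j, rfl⟩
    omega
  intro s
  induction s with
  | zero =>
    intro M h1 _ h2
    have : M = 1 := by
      ext i j
      by_cases hij : i = j
      · rw [hij, h1, Matrix.one_apply_eq]
      · rw [h2 i j hij (Nat.zero_le _), Matrix.one_apply_ne hij]
    rw [this, v.detDeg_one]
  | succ s ih =>
    intro M h1 h0 h2
    by_cases hs : ∃ j, r j = s
    · obtain ⟨j, rfl⟩ := hs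
      let u : Fin k → K := fun i => if i = j then 0 else M i j
      let M' := Matrix.updateCol M j (Pi.single j 1)
      have hM : M = M' * (1 + Matrix.vecMulVec u (Pi.single j 1)) := by
        have hMu : Matrix.mulVec M' u = u := by
          ext i
          rw [Matrix.mulVec, dotProduct, Finset.sum_eq_single i]
          · by_cases hij : i = j
            · simp [u, hij]
            · simp [M', hij, h1]
          · intro l _ hl
            by_cases hlj : l = j
            · simp [u, hlj]
            · by_cases hr' : r l ≤ r j
              · simp [u, hlj, h0 l j hlj hr']
              · simp [M', hlj, h2 i l hl.symm (by omega)]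
          · simp
        rw [mul_add, mul_one, Matrix.mul_vecMulVec, hMu]
        ext a b
        by_cases hb : b = j
        · subst hb
          by_cases ha : a = b
          · simp [M', u, ha, h1, Matrix.vecMulVec_apply]
          · simp [M', u, ha, Matrix.vecMulVec_apply]
        · simp [M', u, hb, Matrix.vecMulVec_apply]
      rw [hM, v.detDeg_mul, v.detDeg_one_add_vecMulVec_single_right j (by simp [u]), add_zero]
      apply ih
      · intro i
        by_cases hij : i = j
        · simp [M', hij]
        · simp [M', hij, h1]
      · intro i l hil hrl
        by_cases hlj : l = j
        · subst hlj
          simp [M', hil]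
        · simp [M', hlj, h0 i l hil hrl]
      · intro i l hil hrl
        by_cases hlj : l = j
        · subst hlj
          simp [M', hil]
        · have : r l ≠ r j := fun h => hlj (hr h)
          simp [M', hlj, h2 i l hil (by omega)]
    · exact ih M h1 h0 fun i j hij hj => h2 i j hij (by
        have : r j ≠ s := fun h => hs ⟨j, h⟩
        omega)

theorem detDeg_of_isLowerUnitriangular {L : Matrix (Fin k) (Fin k) K}
    (hL : IsLowerUnitriangular L) : v.detDeg L = 0 :=
  v.detDeg_unitriangular (fun i => (i : ℕ)) Fin.val_injective hL.1 fun i j hij h =>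
    hL.2 i j (lt_of_le_of_ne h hij)

theorem detDeg_of_isUpperUnitriangular {U : Matrix (Fin k) (Fin k) K}
    (hU : IsUpperUnitriangular U) : v.detDeg U = 0 :=
  v.detDeg_unitriangular (fun i => (Fin.rev i : ℕ))
    (Fin.val_injective.comp Fin.rev_injective) hU.1 fun i j hij h =>
    hU.2 i j (lt_of_le_of_ne (Fin.rev_le_rev.1 h) hij.symm)

end DegreeFunction

/-! ### Elimination -/

namespace Matrix

variable {K : Type*} [DivisionRing K] {k : ℕ}

/-- The matrix whose row `i` and column `j` vanish except for the common entry `a`, and which is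
`X` elsewhere. -/
def border (i j : Fin (k + 1)) (a : K) (X : Matrix (Fin k) (Fin k) K) :
    Matrix (Fin (k + 1)) (Fin (k + 1)) K :=
  Fin.insertNth (α := fun _ => Fin (k + 1) → K) i (Pi.single j a)
    fun r => Fin.insertNth (α := fun _ => K) j 0 (X r)

variable (i j : Fin (k + 1)) (a : K) (X : Matrix (Fin k) (Fin k) K)

@[simp] theorem border_same : border i j a X i j = a := by simp [border]

@[simp] theorem border_row (c : Fin k) : border i j a X i (j.succAbove c) = 0 := by
  simp [border, Fin.succAbove_ne]

@[simp] theorem border_col (r : Fin k) : border i j a X (i.succAbove r) j = 0 := by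
  simp [border]

@[simp] theorem border_succAbove (r c : Fin k) :
    border i j a X (i.succAbove r) (j.succAbove c) = X r c := by
  simp [border]

@[simp] theorem border_zero_row (c : Fin k) : border i 0 a X i c.succ = 0 := by
  rw [← Fin.zero_succAbove, border_row]

@[simp] theorem border_succAbove_succ (r c : Fin k) :
    border i 0 a X (i.succAbove r) c.succ = X r c := by
  rw [← Fin.zero_succAbove, border_succAbove]

theorem border_ext {R : Type*} {M N : Matrix (Fin (k + 1)) (Fin (k + 1)) R} (i j : Fin (k + 1))
    (h1 : M i j = N i j) (h2 : ∀ c, M i (j.succAbove c) = N i (j.succAbove c))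
    (h3 : ∀ r, M (i.succAbove r) j = N (i.succAbove r) j)
    (h4 : ∀ r c, M (i.succAbove r) (j.succAbove c) = N (i.succAbove r) (j.succAbove c)) :
    M = N := by
  ext r c
  rcases Fin.eq_self_or_eq_succAbove i r with rfl | ⟨r, rfl⟩ <;>
    rcases Fin.eq_self_or_eq_succAbove j c with rfl | ⟨c, rfl⟩
  · exact h1
  · exact h2 c
  · exact h3 r
  · exact h4 r c

theorem border_mul_border (i j l : Fin (k + 1)) (a b : K) (X Y : Matrix (Fin k) (Fin k) K) :
    border i j a X * border j l b Y = border i l (a * b) (X * Y) := by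
  apply border_ext i l <;> intros <;>
    simp [Matrix.mul_apply, Fin.sum_univ_succAbove _ j]

theorem border_one (i : Fin (k + 1)) : border i i (1 : K) 1 = 1 := by
  apply border_ext i i <;> intros <;>
    simp [Matrix.one_apply, Fin.succAbove_ne, (Fin.succAbove_ne _ _).symm]

theorem border_diagonal (a : K) (d : Fin k → K) :
    border 0 0 a (diagonal d) = diagonal (Fin.cons a d : Fin (k + 1) → K) := by
  apply border_ext 0 0
  · simp
  · intro c
    rw [border_row, diagonal_apply_ne _ (Fin.succAbove_ne _ _).symm]
  · intro r
    rw [border_col, diagonal_apply_ne _ (Fin.succAbove_ne _ _)]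
  · intro r c
    rw [border_succAbove]
    simp [diagonal_apply]

variable {X} in
theorem isUnit_of_isUnit_border (h : IsUnit (border i j a X)) : IsUnit X := by
  obtain ⟨Y, hY, -⟩ := isUnit_iff_exists.1 h
  refine IsUnit.of_mul_eq_one (Y.submatrix j.succAbove i.succAbove) ?_
  ext r c
  have := congrFun (congrFun hY (i.succAbove r)) (i.succAbove c)
  rw [Matrix.mul_apply, Fin.sum_univ_succAbove _ j] at this
  simpa [Matrix.one_apply, Matrix.mul_apply] using this

/-- Elimination of a row and of a column with a nonzero entry `A i j`. -/
theorem eq_mul_border_mul (A : Matrix (Fin (k + 1)) (Fin (k + 1)) K) (hij : A i j ≠ 0) :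
    A = (1 + vecMulVec (i.insertNth (α := fun _ => K) 0 fun r => A (i.succAbove r) j * (A i j)⁻¹)
        (Pi.single i 1)) *
      border i j (A i j) (of fun r c => A (i.succAbove r) (j.succAbove c) -
        A (i.succAbove r) j * (A i j)⁻¹ * A i (j.succAbove c)) *
      (1 + vecMulVec (Pi.single j 1)
        (j.insertNth (α := fun _ => K) 0 fun c => (A i j)⁻¹ * A i (j.succAbove c))) := by
  rw [add_mul, one_mul, vecMulVec_mul, single_one_vecMul, mul_add, mul_one, mul_vecMulVec,
    mulVec_single_one]
  apply border_ext i j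
  · simp [vecMulVec_apply]
  · intro c
    simp [vecMulVec_apply, hij]
  · intro r
    simp [vecMulVec_apply, hij]
  · intro r c
    simp [vecMulVec_apply, hij, mul_assoc]

end Matrix

/-! ### Unitriangular matrices and the Bruhat normal form -/

section Bruhat

variable {K : Type*} [DivisionRing K] {k : ℕ}

theorem IsLowerUnitriangular.mul {A B : Matrix (Fin k) (Fin k) K} (hA : IsLowerUnitriangular A)
    (hB : IsLowerUnitriangular B) : IsLowerUnitriangular (A * B) := by
  constructor
  · intro i
    rw [Matrix.mul_apply, Finset.sum_eq_single i, hA.1, hB.1, one_mul]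
    · intro l _ hl
      rcases lt_or_gt_of_ne hl with h | h
      · rw [hB.2 l i h, mul_zero]
      · rw [hA.2 i l h, zero_mul]
    · simp
  · intro i j hij
    rw [Matrix.mul_apply]
    refine Finset.sum_eq_zero fun l _ => ?_
    rcases lt_or_ge i l with h | h
    · rw [hA.2 i l h, zero_mul]
    · rw [hB.2 l j (h.trans_lt hij), mul_zero]

theorem IsUpperUnitriangular.mul {A B : Matrix (Fin k) (Fin k) K} (hA : IsUpperUnitriangular A)
    (hB : IsUpperUnitriangular B) : IsUpperUnitriangular (A * B) := by
  constructor
  · intro i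
    rw [Matrix.mul_apply, Finset.sum_eq_single i, hA.1, hB.1, one_mul]
    · intro l _ hl
      rcases lt_or_gt_of_ne hl with h | h
      · rw [hA.2 i l h, zero_mul]
      · rw [hB.2 l i h, mul_zero]
    · simp
  · intro i j hij
    rw [Matrix.mul_apply]
    refine Finset.sum_eq_zero fun l _ => ?_
    rcases lt_or_ge l i with h | h
    · rw [hA.2 i l h, zero_mul]
    · rw [hB.2 l j (hij.trans_le h), mul_zero]

theorem IsLowerUnitriangular.border {L : Matrix (Fin k) (Fin k) K} (hL : IsLowerUnitriangular L)
    (i : Fin (k + 1)) : IsLowerUnitriangular (Matrix.border i i 1 L) := by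
  constructor
  · intro r
    rcases Fin.eq_self_or_eq_succAbove i r with rfl | ⟨r, rfl⟩ <;> simp [hL.1]
  · intro r c hrc
    obtain hr | ⟨r, rfl⟩ := Fin.eq_self_or_eq_succAbove i r <;>
      obtain hc | ⟨c, rfl⟩ := Fin.eq_self_or_eq_succAbove i c <;> subst_vars
    · exact absurd hrc (lt_irrefl _)
    · simp
    · simp
    · rw [Matrix.border_succAbove]
      exact hL.2 r c (Fin.succAbove_lt_succAbove_iff.1 hrc)

theorem IsUpperUnitriangular.border {U : Matrix (Fin k) (Fin k) K} (hU : IsUpperUnitriangular U)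
    (i : Fin (k + 1)) : IsUpperUnitriangular (Matrix.border i i 1 U) := by
  constructor
  · intro r
    rcases Fin.eq_self_or_eq_succAbove i r with rfl | ⟨r, rfl⟩ <;> simp [hU.1]
  · intro r c hrc
    obtain hr | ⟨r, rfl⟩ := Fin.eq_self_or_eq_succAbove i r <;>
      obtain hc | ⟨c, rfl⟩ := Fin.eq_self_or_eq_succAbove i c <;> subst_vars
    · exact absurd hrc (lt_irrefl _)
    · simp
    · simp
    · rw [Matrix.border_succAbove]
      exact hU.2 r c (Fin.succAbove_lt_succAbove_iff.1 hrc)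

/-- The permutation sending `i` to `j` and `i.succAbove r` to `j.succAbove (σ r)`. -/
theorem exists_perm_succAbove (i j : Fin (k + 1)) (σ : Equiv.Perm (Fin k)) :
    ∃ τ : Equiv.Perm (Fin (k + 1)), τ i = j ∧ ∀ r, τ (i.succAbove r) = j.succAbove (σ r) :=
  ⟨(finSuccEquiv' i).trans ((Equiv.optionCongr σ).trans (finSuccEquiv' j).symm), by simp,
    by simp⟩

/-- Every nonsingular matrix has a Bruhat normal form. -/
theorem exists_isBruhatForm {A : Matrix (Fin k) (Fin k) K} (hA : IsUnit A) :
    ∃ (d : Fin k → Kˣ) (σ : Equiv.Perm (Fin k)), IsBruhatForm A d σ := by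
  induction k with
  | zero =>
    exact ⟨fun i => i.elim0, 1, 1, 1, ⟨fun i => i.elim0, fun i => i.elim0⟩,
      ⟨fun i => i.elim0, fun i => i.elim0⟩, Subsingleton.elim _ _⟩
  | succ k ih =>
    have hcol : ∃ i, A i 0 ≠ 0 := by
      by_contra! h
      obtain ⟨B, -, hB⟩ := isUnit_iff_exists.1 hA
      have := congrFun (congrFun hB 0) 0
      simp [Matrix.mul_apply, h] at this
    obtain ⟨i, hi, hmin⟩ : ∃ i, A i 0 ≠ 0 ∧ ∀ r, r < i → A r 0 = 0 := by
      obtain ⟨i, hi⟩ := exists_minimal_of_wellFoundedLT (fun i => A i 0 ≠ 0) hcol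
      exact ⟨i, hi.prop, fun r hr => by_contra fun h => hi.not_lt h hr⟩
    have hdec := Matrix.eq_mul_border_mul i 0 A hi
    set u : Fin (k + 1) → K := i.insertNth (α := fun _ => K) 0
      fun r => A (i.succAbove r) 0 * (A i 0)⁻¹ with hu
    set w : Fin (k + 1) → K := Fin.insertNth (α := fun _ => K) 0 0
      fun c => (A i 0)⁻¹ * A i (Fin.succAbove 0 c) with hw
    set X := Matrix.of fun (r c : Fin k) => A (i.succAbove r) (Fin.succAbove 0 c) -
        A (i.succAbove r) 0 * (A i 0)⁻¹ * A i (Fin.succAbove 0 c)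
    have hL1 : IsLowerUnitriangular (1 + Matrix.vecMulVec u (Pi.single i 1)) := by
      constructor
      · intro r
        by_cases hr : r = i
        · subst hr
          simp [Matrix.vecMulVec_apply, hu]
        · simp [Matrix.vecMulVec_apply, hr]
      · intro r c hrc
        by_cases hc : c = i
        · subst hc
          obtain ⟨r, rfl⟩ := Fin.exists_succAbove_eq hrc.ne
          simp [Matrix.vecMulVec_apply, hu, hrc.ne, hmin _ hrc]
        · simp [Matrix.vecMulVec_apply, hrc.ne, hc]
    have hU1 : IsUpperUnitriangular (1 + Matrix.vecMulVec (Pi.single 0 1) w) := by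
      constructor
      · intro r
        by_cases hr : r = 0
        · subst hr
          simp [Matrix.vecMulVec_apply, hw]
        · simp [Matrix.vecMulVec_apply, hr]
      · intro r c hrc
        simp [Matrix.vecMulVec_apply, hrc.ne', (Fin.zero_le c).trans_lt hrc |>.ne']
    have hX : IsUnit X := by
      rw [hdec] at hA
      exact Matrix.isUnit_of_isUnit_border _ _ _
        (isUnit_of_mul_isUnit_right (isUnit_of_mul_isUnit_left hA))
    obtain ⟨d, σ, L, U, hL, hU, hLU⟩ := ih hX
    obtain ⟨τ, hτi, hτ⟩ := exists_perm_succAbove i 0 σ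
    refine ⟨i.insertNth (α := fun _ => Kˣ) (Units.mk0 _ hi) d, τ, _, _,
      hL1.mul (hL.border i), (hU.border 0).mul hU1, ?_⟩
    have hmid : Matrix.diagonal (fun r => ((i.insertNth (α := fun _ => Kˣ) (Units.mk0 _ hi) d r :
        Kˣ) : K)) * τ.permMatrix K =
        Matrix.border i 0 (A i 0) (Matrix.diagonal (fun r => (d r : K)) * σ.permMatrix K) := by
      apply Matrix.border_ext i 0 <;> intros <;>
        simp [Matrix.diagonal_mul, hτi, hτ, PEquiv.toMatrix_apply, (Fin.succ_ne_zero _).symm]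
    have hB : Matrix.border i 0 (A i 0) X = Matrix.border i i 1 L *
        Matrix.border i 0 (A i 0) (Matrix.diagonal (fun r => (d r : K)) * σ.permMatrix K) *
          Matrix.border 0 0 1 U := by
      rw [Matrix.border_mul_border, Matrix.border_mul_border, one_mul, mul_one, ← mul_assoc, ← hLU]
    refine hdec.trans ?_
    rw [hB, ← hmid]
    simp only [mul_assoc]

end Bruhat

namespace DegreeFunction

variable {K : Type*} [DivisionRing K] (v : DegreeFunction K) {k : ℕ}

variable {v} in
theorem IsBiproper.border {X : Matrix (Fin k) (Fin k) K} (hX : v.IsBiproper X)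
    (i j : Fin (k + 1)) : v.IsBiproper (Matrix.border i j 1 X) := by
  have key : ∀ (i j : Fin (k + 1)) (Y : Matrix (Fin k) (Fin k) K), v.IsProper Y →
      v.IsProper (Matrix.border i j 1 Y) := by
    intro i j Y hY r c
    obtain hr | ⟨r, rfl⟩ := Fin.eq_self_or_eq_succAbove i r <;>
      obtain hc | ⟨c, rfl⟩ := Fin.eq_self_or_eq_succAbove j c <;> subst_vars
    · simp [deg_one]
    · simp [deg_zero]
    · simp [deg_zero]
    · rw [Matrix.border_succAbove]
      exact hY r c
  obtain ⟨hX, Y, h1, h2, hY⟩ := hX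
  refine ⟨key i j X hX, Matrix.border j i 1 Y, ?_, ?_, key j i Y hY⟩
  · rw [Matrix.border_mul_border, h1, one_mul, Matrix.border_one]
  · rw [Matrix.border_mul_border, h2, one_mul, Matrix.border_one]

theorem deg_mul_mul_le {A S T : Matrix (Fin k) (Fin k) K} {d : WithBot ℤ}
    (hA : ∀ i j, v.deg (A i j) ≤ d) (hS : v.IsProper S) (hT : v.IsProper T) (i j : Fin k) :
    v.deg ((S * A * T) i j) ≤ d := by
  rw [Matrix.mul_apply]
  refine v.deg_sum_le _ _ fun c _ => ?_
  rw [v.deg_mul, ← add_zero d, Matrix.mul_apply]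
  refine add_le_add (v.deg_sum_le _ _ fun b _ => ?_) (hT c j)
  rw [v.deg_mul, ← zero_add d]
  exact add_le_add (hS i b) (hA b c)

/-- Every nonsingular matrix is equivalent, by biproper matrices, to a diagonal matrix of powers
of `t`, with exponents in descending order. -/
theorem exists_smith_form {A : Matrix (Fin k) (Fin k) K} (hA : IsUnit A) :
    ∃ (S T : Matrix (Fin k) (Fin k) K) (α : Fin k → ℤ), v.IsBiproper S ∧ v.IsBiproper T ∧
      Antitone α ∧ S * A * T = Matrix.diagonal fun i => v.t ^ α i := by
  induction k with
  | zero =>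
    exact ⟨1, 1, fun i => i.elim0, v.isBiproper_one, v.isBiproper_one, fun i => i.elim0,
      Subsingleton.elim _ _⟩
  | succ k ih =>
    obtain ⟨⟨i, j⟩, hmax⟩ := Finite.exists_max fun p : Fin (k + 1) × Fin (k + 1) =>
      v.deg (A p.1 p.2)
    replace hmax : ∀ r c, v.deg (A r c) ≤ v.deg (A i j) := fun r c => hmax (r, c)
    have hij : A i j ≠ 0 := by
      intro h
      obtain ⟨B, hB, -⟩ := isUnit_iff_exists.1 hA
      have h0 : ∀ r c, A r c = 0 := fun r c => by
        have := hmax r c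
        rwa [h, v.deg_zero, le_bot_iff, v.deg_eq_bot] at this
      have := congrFun (congrFun hB 0) 0
      simp [Matrix.mul_apply, h0] at this
    obtain ⟨m, hm⟩ := v.exists_deg_eq hij
    rw [hm] at hmax
    have hquot : ∀ r c, v.deg (A r c) + ((-m : ℤ) : WithBot ℤ) ≤ 0 := by
      intro r c
      refine (add_le_add (hmax r c) le_rfl).trans ?_
      rw [← WithBot.coe_add]
      simp
    have hdec := Matrix.eq_mul_border_mul i j A hij
    set u : Fin (k + 1) → K := i.insertNth (α := fun _ => K) 0
      fun r => A (i.succAbove r) j * (A i j)⁻¹ with hu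
    set w : Fin (k + 1) → K := j.insertNth (α := fun _ => K) 0
      fun c => (A i j)⁻¹ * A i (j.succAbove c) with hw
    set X := Matrix.of fun (r c : Fin k) => A (i.succAbove r) (j.succAbove c) -
        A (i.succAbove r) j * (A i j)⁻¹ * A i (j.succAbove c) with hX
    have hudeg : ∀ r, v.deg (u r) ≤ 0 := by
      intro r
      obtain rfl | ⟨r, rfl⟩ := Fin.eq_self_or_eq_succAbove i r
      · simp [hu, deg_zero]
      · simpa [hu, v.deg_mul, v.deg_inv hm] using hquot (i.succAbove r) j
    have hwdeg : ∀ c, v.deg (w c) ≤ 0 := by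
      intro c
      obtain rfl | ⟨c, rfl⟩ := Fin.eq_self_or_eq_succAbove j c
      · simp [hw, deg_zero]
      · simpa [hw, v.deg_mul, v.deg_inv hm, add_comm] using hquot i (j.succAbove c)
    have hE : v.IsBiproper (1 + Matrix.vecMulVec u (Pi.single i 1)) := by
      refine v.isBiproper_one_add_vecMulVec (by simp [hu]) fun r c => ?_
      rw [v.deg_mul]
      refine add_nonpos (hudeg r) ?_
      by_cases hc : c = i
      · simp [hc, deg_one]
      · simp [hc, deg_zero]
    have hE' : v.IsBiproper (1 + Matrix.vecMulVec (Pi.single j 1) w) := by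
      refine v.isBiproper_one_add_vecMulVec (by simp [hw]) fun r c => ?_
      rw [v.deg_mul]
      refine add_nonpos ?_ (hwdeg c)
      by_cases hr : r = j
      · simp [hr, deg_one]
      · simp [hr, deg_zero]
    obtain ⟨-, G, -, hG, hGp⟩ := id hE
    obtain ⟨-, G', hG', -, hGp'⟩ := id hE'
    have hGb : v.IsBiproper G := ⟨hGp, _, hG, mul_eq_one_comm.1 hG, hE.1⟩
    have hGb' : v.IsBiproper G' := ⟨hGp', _, mul_eq_one_comm.1 hG', hG', hE'.1⟩
    have hXu : IsUnit X := by
      rw [hdec] at hA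
      exact Matrix.isUnit_of_isUnit_border _ _ _
        (isUnit_of_mul_isUnit_right (isUnit_of_mul_isUnit_left hA))
    obtain ⟨S, T, α, hS, hT, hα, hST⟩ := ih hXu
    have hXdeg : ∀ r c, v.deg (X r c) ≤ m := by
      intro r c
      refine (v.deg_sub_le _ _).trans (max_le (hmax _ _) ?_)
      rw [v.deg_mul, v.deg_mul, v.deg_inv hm, ← zero_add (m : WithBot ℤ)]
      exact add_le_add (hquot _ _) (hmax _ _)
    have hαm : ∀ r, α r ≤ m := by
      intro r
      have := v.deg_mul_mul_le hXdeg hS.1 hT.1 r r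
      rw [hST, Matrix.diagonal_apply_eq, v.deg_t_zpow] at this
      exact WithBot.coe_le_coe.1 this
    set b := v.t ^ m * (A i j)⁻¹ with hb
    have hbdeg : v.deg b = ((0 : ℤ) : WithBot ℤ) := by
      rw [hb, v.deg_mul, v.deg_t_zpow, v.deg_inv hm, ← WithBot.coe_add, add_neg_cancel]
    set D : Matrix (Fin (k + 1)) (Fin (k + 1)) K := Matrix.diagonal (Fin.cons b fun _ => 1)
    have hD : v.IsBiproper D := by
      have key : ∀ x : K, v.deg x ≤ 0 → v.IsProper (Matrix.diagonal (Fin.cons x fun _ => 1 :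
          Fin (k + 1) → K)) := by
        intro x hx r c
        rw [Matrix.diagonal_apply]
        split_ifs
        · refine Fin.cases ?_ (fun r => ?_) r
          · exact hx
          · exact v.deg_one.le
        · simp [deg_zero]
      have hb0 := v.ne_zero_of_deg hbdeg
      refine ⟨key b hbdeg.le, _, ?_, ?_, key b⁻¹ (v.deg_inv hbdeg).le⟩
      all_goals
        rw [Matrix.diagonal_mul_diagonal, ← Matrix.diagonal_one]
        congr 1
        ext r
        refine Fin.cases ?_ (fun r => ?_) r <;> simp [hb0]
    refine ⟨D * Matrix.border 0 i 1 S * G, G' * Matrix.border j 0 1 T, Fin.cons m α,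
      (hD.mul (hS.border 0 i)).mul hGb, hGb'.mul (hT.border j 0), ?_, ?_⟩
    · intro r c
      refine Fin.cases ?_ (fun r => ?_) r <;> refine Fin.cases ?_ (fun c => ?_) c <;> intro hrc
      · exact le_rfl
      · exact hαm c
      · exact absurd hrc (by simp)
      · exact hα (Fin.succ_le_succ_iff.1 hrc)
    · calc D * Matrix.border 0 i 1 S * G * A * (G' * Matrix.border j 0 1 T)
          = D * Matrix.border 0 i 1 S * (G * (1 + Matrix.vecMulVec u (Pi.single i 1))) *
              Matrix.border i j (A i j) X *
              ((1 + Matrix.vecMulVec (Pi.single j 1) w) * G') * Matrix.border j 0 1 T := by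
            conv_lhs => rw [hdec]
            simp only [mul_assoc]
        _ = D * (Matrix.border 0 i 1 S * Matrix.border i j (A i j) X * Matrix.border j 0 1 T) := by
            rw [hG, hG', mul_one, mul_one]
            simp only [mul_assoc]
        _ = _ := by
            rw [Matrix.border_mul_border, Matrix.border_mul_border, hST, one_mul, mul_one,
              Matrix.border_diagonal, Matrix.diagonal_mul_diagonal]
            congr 1
            ext r
            refine Fin.cases ?_ (fun r => ?_) r <;> simp [hb, hij]

/-! ### Expansion of the determinant along sums of rows or columns -/

theorem deg_le_detDeg_updateRow_one (i : Fin k) (y : Fin k → K) :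
    v.deg (y i) ≤ v.detDeg (Matrix.updateRow 1 i y) := by
  by_cases hy : y i = 0
  · simp [hy, deg_zero]
  have h : Matrix.updateRow 1 i y = Matrix.diagonal (Function.update 1 i (y i)) *
      (1 + Matrix.vecMulVec (Pi.single i 1) ((y i)⁻¹ • y - Pi.single i 1)) := by
    ext r c
    rw [Matrix.diagonal_mul]
    by_cases hr : r = i
    · subst hr
      simp [Matrix.vecMulVec_apply, Matrix.one_apply, Pi.single_apply, hy, eq_comm]
    · simp [hr, Matrix.vecMulVec_apply, Matrix.one_apply]
  rw [h, v.detDeg_mul, v.detDeg_one_add_vecMulVec_single_left i (by simp [hy]), add_zero,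
    v.detDeg_diagonal, Finset.sum_eq_single i]
  · simp
  · intro r _ hr
    simp [hr, deg_one]
  · simp

theorem deg_le_detDeg_updateCol_one (i : Fin k) (y : Fin k → K) :
    v.deg (y i) ≤ v.detDeg (Matrix.updateCol 1 i y) := by
  by_cases hy : y i = 0
  · simp [hy, deg_zero]
  have h : Matrix.updateCol 1 i y =
      (1 + Matrix.vecMulVec ((fun r => y r * (y i)⁻¹) - Pi.single i 1) (Pi.single i 1)) *
      Matrix.diagonal (Function.update 1 i (y i)) := by
    ext r c
    rw [Matrix.mul_diagonal]
    by_cases hc : c = i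
    · subst hc
      simp [Matrix.vecMulVec_apply, Matrix.one_apply, Pi.single_apply, hy]
    · simp [hc, Matrix.vecMulVec_apply, Matrix.one_apply]
  rw [h, v.detDeg_mul, v.detDeg_one_add_vecMulVec_single_right i (by simp [hy]), zero_add,
    v.detDeg_diagonal, Finset.sum_eq_single i]
  · simp
  · intro r _ hr
    simp [hr, deg_one]
  · simp

theorem detDeg_updateRow_sum_le {ι : Type*} (s : Finset ι) (M : Matrix (Fin k) (Fin k) K)
    (i : Fin k) (a : ι → K) (x : ι → Fin k → K) {d : WithBot ℤ} (ha : ∀ l, v.deg (a l) ≤ 0)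
    (h : ∀ l ∈ s, v.detDeg (M.updateRow i (x l)) ≤ d) :
    v.detDeg (M.updateRow i (∑ l ∈ s, a l • x l)) ≤ d := by
  by_cases hB : IsUnit (M.updateRow i (∑ l ∈ s, a l • x l))
  swap
  · simp [v.detDeg_of_not_isUnit hB]
  set B := M.updateRow i (∑ l ∈ s, a l • x l) with hBdef
  obtain ⟨C, hBC, hCB⟩ := isUnit_iff_exists.1 hB
  have key : ∀ y, M.updateRow i y = Matrix.updateRow 1 i (Matrix.vecMul y C) * B := by
    intro y
    rw [Matrix.updateRow_mul, one_mul, Matrix.vecMul_vecMul, hCB, Matrix.vecMul_one, hBdef,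
      Matrix.updateRow_idem]
  have hone : ∑ l ∈ s, a l * Matrix.vecMul (x l) C i = 1 := by
    have h1 := congrFun (congrFun hBC i) i
    rw [Matrix.one_apply_eq] at h1
    rw [← h1, Matrix.mul_apply_eq_vecMul, hBdef, Matrix.updateRow_self, Matrix.sum_vecMul,
      Finset.sum_apply]
    simp [Matrix.smul_vecMul]
  obtain ⟨l, hl, hdeg⟩ : ∃ l ∈ s, 0 ≤ v.deg (Matrix.vecMul (x l) C i) := by
    by_contra! hlt
    have : v.deg 1 ≤ ((-1 : ℤ) : WithBot ℤ) := by
      rw [← hone]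
      refine v.deg_sum_le _ _ fun l hl => ?_
      rw [v.deg_mul, ← zero_add ((-1 : ℤ) : WithBot ℤ)]
      refine add_le_add (ha l) ?_
      have := hlt l hl
      cases hh : v.deg (Matrix.vecMul (x l) C i) with
      | bot => simp
      | coe z =>
        rw [hh] at this
        norm_cast at this ⊢
        omega
    rw [v.deg_one] at this
    norm_cast at this
  refine le_trans ?_ (h l hl)
  rw [key (x l), v.detDeg_mul]
  exact le_add_of_nonneg_left (hdeg.trans (v.deg_le_detDeg_updateRow_one _ _))

theorem detDeg_updateCol_sum_le {ι : Type*} (s : Finset ι) (M : Matrix (Fin k) (Fin k) K)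
    (i : Fin k) (a : ι → K) (x : ι → Fin k → K) {d : WithBot ℤ} (ha : ∀ l, v.deg (a l) ≤ 0)
    (h : ∀ l ∈ s, v.detDeg (M.updateCol i (x l)) ≤ d) :
    v.detDeg (M.updateCol i (∑ l ∈ s, MulOpposite.op (a l) • x l)) ≤ d := by
  by_cases hB : IsUnit (M.updateCol i (∑ l ∈ s, MulOpposite.op (a l) • x l))
  swap
  · simp [v.detDeg_of_not_isUnit hB]
  set B := M.updateCol i (∑ l ∈ s, MulOpposite.op (a l) • x l) with hBdef
  obtain ⟨C, hBC, hCB⟩ := isUnit_iff_exists.1 hB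
  have key : ∀ y, M.updateCol i y = B * Matrix.updateCol 1 i (Matrix.mulVec C y) := by
    intro y
    rw [Matrix.mul_updateCol, mul_one, Matrix.mulVec_mulVec, hBC, Matrix.one_mulVec, hBdef,
      Matrix.updateCol_idem]
  have hone : ∑ l ∈ s, Matrix.mulVec C (x l) i * a l = 1 := by
    have h1 := congrFun (congrFun hCB i) i
    rw [Matrix.one_apply_eq] at h1
    rw [← h1]
    change _ = Matrix.mulVec C (fun r => B r i) i
    have : (fun r => B r i) = ∑ l ∈ s, MulOpposite.op (a l) • x l := by
      ext r
      rw [hBdef, Matrix.updateCol_self]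
    rw [this, Matrix.mulVec_sum, Finset.sum_apply]
    simp [Matrix.mulVec_smul]
  obtain ⟨l, hl, hdeg⟩ : ∃ l ∈ s, 0 ≤ v.deg (Matrix.mulVec C (x l) i) := by
    by_contra! hlt
    have : v.deg 1 ≤ ((-1 : ℤ) : WithBot ℤ) := by
      rw [← hone]
      refine v.deg_sum_le _ _ fun l hl => ?_
      rw [v.deg_mul, ← add_zero ((-1 : ℤ) : WithBot ℤ)]
      refine add_le_add ?_ (ha l)
      have := hlt l hl
      cases hh : v.deg (Matrix.mulVec C (x l) i) with
      | bot => simp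
      | coe z =>
        rw [hh] at this
        norm_cast at this ⊢
        omega
    rw [v.deg_one] at this
    norm_cast at this
  refine le_trans ?_ (h l hl)
  rw [key (x l), v.detDeg_mul]
  exact le_add_of_nonneg_right (hdeg.trans (v.deg_le_detDeg_updateCol_one _ _))

/-- A form of the Cauchy-Binet formula for degrees. -/
theorem detDeg_mul_le_of_isProper_left {m : Type*} [Fintype m] {X : Matrix (Fin k) m K}
    {Y : Matrix m (Fin k) K} {d : WithBot ℤ} (hX : v.IsProper X)
    (h : ∀ f : Fin k → m, v.detDeg (Y.submatrix f id) ≤ d) : v.detDeg (X * Y) ≤ d := by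
  suffices H : ∀ (s : Finset (Fin k)) (f : Fin k → m),
      v.detDeg (Matrix.of fun i => if i ∈ s then (X * Y) i else Y (f i)) ≤ d by
    rcases isEmpty_or_nonempty (Fin k → m) with he | ⟨⟨f⟩⟩
    · rw [isEmpty_fun] at he
      obtain ⟨⟨i⟩, hm⟩ := he
      rw [v.detDeg_of_not_isUnit]
      · exact bot_le
      · intro hu
        obtain ⟨B, hB, -⟩ := isUnit_iff_exists.1 hu
        have := congrFun (congrFun hB i) i
        simp [Matrix.mul_apply] at this
    · have := H Finset.univ f
      simp only [Finset.mem_univ, if_true] at this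
      exact this
  intro s
  induction s using Finset.induction_on with
  | empty => exact fun f => h f
  | insert a s ha ih =>
    intro f
    have := v.detDeg_updateRow_sum_le Finset.univ
      (Matrix.of fun i => if i ∈ s then (X * Y) i else Y (f i)) a (X a) Y (d := d) (hX a) (by
        intro l _
        convert ih (Function.update f a l) using 2
        ext i j
        by_cases hi : i = a
        · subst hi
          simp [ha]
        · simp [hi])
    convert this using 2
    ext i j
    by_cases hi : i = a
    · subst hi
      simp [Matrix.mul_apply]
    · simp [hi]

theorem detDeg_mul_le_of_isProper_right {m : Type*} [Fintype m] {X : Matrix (Fin k) m K}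
    {Y : Matrix m (Fin k) K} {d : WithBot ℤ} (hY : v.IsProper Y)
    (h : ∀ f : Fin k → m, v.detDeg (X.submatrix id f) ≤ d) : v.detDeg (X * Y) ≤ d := by
  suffices H : ∀ (s : Finset (Fin k)) (f : Fin k → m),
      v.detDeg (Matrix.of fun i j => if j ∈ s then (X * Y) i j else X i (f j)) ≤ d by
    rcases isEmpty_or_nonempty (Fin k → m) with he | ⟨⟨f⟩⟩
    · rw [isEmpty_fun] at he
      obtain ⟨⟨i⟩, hm⟩ := he
      rw [v.detDeg_of_not_isUnit]
      · exact bot_le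
      · intro hu
        obtain ⟨B, hB, -⟩ := isUnit_iff_exists.1 hu
        have := congrFun (congrFun hB i) i
        simp [Matrix.mul_apply] at this
    · have := H Finset.univ f
      simp only [Finset.mem_univ, if_true] at this
      exact this
  intro s
  induction s using Finset.induction_on with
  | empty => exact fun f => h f
  | insert a s ha ih =>
    intro f
    have := v.detDeg_updateCol_sum_le Finset.univ
      (Matrix.of fun i j => if j ∈ s then (X * Y) i j else X i (f j)) a (fun l => Y l a)
      (fun l i => X i l) (d := d) (fun l => hY l a) (by
        intro l _
        convert ih (Function.update f a l) using 2
        ext i j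
        by_cases hj : j = a
        · subst hj
          simp [ha]
        · simp [hj])
    convert this using 2
    ext i j
    by_cases hj : j = a
    · subst hj
      simp [Matrix.mul_apply]
    · simp [hj]

end DegreeFunction

namespace DegreeFunction

variable {K : Type*} [DivisionRing K] (v : DegreeFunction K) {k n : ℕ}

/-- A bound for the minors with ordered rows and columns holds for arbitrary choices of rows. -/
theorem detDeg_submatrix_le_of_orderEmb_left {Y : Matrix (Fin n) (Fin k) K} {d : WithBot ℤ}
    (h : ∀ f : Fin k ↪o Fin n, v.detDeg (Y.submatrix f id) ≤ d) (f : Fin k → Fin n) :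
    v.detDeg (Y.submatrix f id) ≤ d := by
  by_cases hf : Function.Injective f
  · have hs : StrictMono (f ∘ Tuple.sort f) :=
      (Tuple.monotone_sort f).strictMono_of_injective (hf.comp (Tuple.sort f).injective)
    have hP := v.isBiproper_permMatrix (k := k) (Tuple.sort f)
    have := v.detDeg_mul ((Tuple.sort f).permMatrix K) (Y.submatrix f id)
    rw [hP.detDeg_eq, zero_add, PEquiv.toMatrix_toPEquiv_mul, Matrix.submatrix_submatrix]
      at this
    rw [← this]
    exact h (OrderEmbedding.ofStrictMono _ hs)
  · rw [v.detDeg_of_not_isUnit]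
    · exact bot_le
    · intro hu
      obtain ⟨B, hB, -⟩ := isUnit_iff_exists.1 hu
      obtain ⟨a, b, hab, hne⟩ := Function.not_injective_iff.1 hf
      have h1 := congrFun (congrFun hB a) a
      have h2 := congrFun (congrFun hB b) a
      simp only [Matrix.mul_apply, Matrix.submatrix_apply, hab, Matrix.one_apply_eq,
        Matrix.one_apply_ne hne.symm] at h1 h2
      exact one_ne_zero (h1.symm.trans h2)

/-- A bound for the minors with ordered rows and columns holds for arbitrary choices of
columns. -/
theorem detDeg_submatrix_le_of_orderEmb_right {Y : Matrix (Fin k) (Fin n) K} {d : WithBot ℤ}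
    (h : ∀ f : Fin k ↪o Fin n, v.detDeg (Y.submatrix id f) ≤ d) (f : Fin k → Fin n) :
    v.detDeg (Y.submatrix id f) ≤ d := by
  by_cases hf : Function.Injective f
  · have hs : StrictMono (f ∘ Tuple.sort f) :=
      (Tuple.monotone_sort f).strictMono_of_injective (hf.comp (Tuple.sort f).injective)
    have hP := v.isBiproper_permMatrix (k := k) (Tuple.sort f)⁻¹
    have := v.detDeg_mul (Y.submatrix id f) ((Tuple.sort f)⁻¹.permMatrix K)
    rw [hP.detDeg_eq, add_zero, PEquiv.mul_toMatrix_toPEquiv, Matrix.submatrix_submatrix]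
      at this
    rw [← this]
    exact h (OrderEmbedding.ofStrictMono _ hs)
  · rw [v.detDeg_of_not_isUnit]
    · exact bot_le
    · intro hu
      obtain ⟨B, -, hB⟩ := isUnit_iff_exists.1 hu
      obtain ⟨a, b, hab, hne⟩ := Function.not_injective_iff.1 hf
      have h1 := congrFun (congrFun hB a) a
      have h2 := congrFun (congrFun hB a) b
      simp only [Matrix.mul_apply, Matrix.submatrix_apply, hab, Matrix.one_apply_eq,
        Matrix.one_apply_ne hne] at h1 h2
      exact one_ne_zero (h1.symm.trans h2)

theorem detDeg_submatrix_mul_mul_le {A S T : Matrix (Fin n) (Fin n) K} (hS : v.IsProper S)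
    (hT : v.IsProper T) {d : WithBot ℤ}
    (h : ∀ f g : Fin k ↪o Fin n, v.detDeg (A.submatrix f g) ≤ d) (f g : Fin k ↪o Fin n) :
    v.detDeg ((S * A * T).submatrix f g) ≤ d := by
  have e : (S * A * T).submatrix f g = (S * A).submatrix f id * T.submatrix id g := by
    rw [← Matrix.submatrix_mul _ _ _ _ _ Function.bijective_id]
  rw [e]
  refine v.detDeg_mul_le_of_isProper_right (fun i j => hT i (g j)) fun g' => ?_
  refine v.detDeg_submatrix_le_of_orderEmb_right (Y := (S * A).submatrix f id)
    (fun g'' => ?_) g'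
  have e : ((S * A).submatrix f id).submatrix id g'' = S.submatrix f id * A.submatrix id g'' := by
    rw [← Matrix.submatrix_mul _ _ _ _ _ Function.bijective_id]
    rfl
  rw [e]
  refine v.detDeg_mul_le_of_isProper_left (fun i j => hS (f i) j) fun f' => ?_
  refine v.detDeg_submatrix_le_of_orderEmb_left (Y := A.submatrix id g'') (fun f'' => ?_) f'
  exact h f'' g''

theorem le_orderEmb_apply (f : Fin k ↪o Fin n) (i : Fin k) : (i : ℕ) ≤ f i := by
  obtain ⟨i, hi⟩ := i
  induction i with
  | zero => exact Nat.zero_le _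
  | succ i ih =>
    have h1 := ih (by omega)
    have h2 : f ⟨i, by omega⟩ < f ⟨i + 1, hi⟩ := f.strictMono (by simp)
    have h3 : (f ⟨i, by omega⟩ : ℕ) < f ⟨i + 1, hi⟩ := h2
    simp only at h1 ⊢
    omega

theorem detDeg_submatrix_diagonal_self (α : Fin n → ℤ) (f : Fin k ↪o Fin n) :
    v.detDeg ((Matrix.diagonal fun i => v.t ^ α i).submatrix f f) =
      ((∑ i, α (f i) : ℤ) : WithBot ℤ) := by
  have : (Matrix.diagonal fun i => v.t ^ α i).submatrix f f =
      Matrix.diagonal fun i => v.t ^ α (f i) := Matrix.submatrix_diagonal _ _ f.injective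
  rw [this, v.detDeg_diagonal, WithBot.coe_sum]
  simp [deg_t_zpow]

theorem detDeg_submatrix_diagonal_le {α : Fin n → ℤ} (hα : Antitone α) (hk : k ≤ n)
    (f g : Fin k ↪o Fin n) :
    v.detDeg ((Matrix.diagonal fun i => v.t ^ α i).submatrix f g) ≤
      ((∑ i, α (Fin.castLE hk i) : ℤ) : WithBot ℤ) := by
  by_cases h : Set.range f ⊆ Set.range g
  · have hfg : f = g := by
      have h1 : Finset.univ.image f = Finset.univ.image g := by
        apply Finset.eq_of_subset_of_card_le
        · rw [← Finset.coe_subset]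
          simpa using h
        · rw [Finset.card_image_of_injective _ f.injective,
            Finset.card_image_of_injective _ g.injective]
      rw [← OrderEmbedding.range_inj]
      simpa using congrArg (fun s : Finset (Fin n) => (s : Set (Fin n))) h1
    subst hfg
    rw [v.detDeg_submatrix_diagonal_self, WithBot.coe_le_coe]
    exact Finset.sum_le_sum fun i _ => hα (le_orderEmb_apply f i)
  · rw [v.detDeg_of_not_isUnit]
    · exact bot_le
    · intro hu
      obtain ⟨B, hB, -⟩ := isUnit_iff_exists.1 hu
      obtain ⟨_, ⟨i, rfl⟩, hi⟩ := Set.not_subset.1 h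
      have := congrFun (congrFun hB i) i
      rw [Matrix.mul_apply, Finset.sum_eq_zero, Matrix.one_apply_eq] at this
      · exact zero_ne_one this
      · intro j _
        rw [Matrix.submatrix_apply, Matrix.diagonal_apply_ne _ (fun h => hi ⟨j, h.symm⟩), zero_mul]

/-- The degrees of the minors are determined by the diagonal form. -/
theorem isGreatest_detDeg_submatrix {A S T : Matrix (Fin n) (Fin n) K} {α : Fin n → ℤ}
    (hS : v.IsBiproper S) (hT : v.IsBiproper T) (hα : Antitone α)
    (hST : S * A * T = Matrix.diagonal fun i => v.t ^ α i) (hk : k ≤ n) :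
    IsGreatest {d | ∃ f g : Fin k ↪o Fin n, d = v.detDeg (A.submatrix f g)}
      ((∑ i, α (Fin.castLE hk i) : ℤ) : WithBot ℤ) := by
  obtain ⟨hSp, S', -, hS', hSp'⟩ := hS
  obtain ⟨hTp, T', hT', -, hTp'⟩ := hT
  have hA : A = S' * (Matrix.diagonal fun i => v.t ^ α i) * T' := by
    rw [← hST]
    simp only [mul_assoc, hT', mul_one]
    rw [← mul_assoc, hS', one_mul]
  have hle : ∀ f g : Fin k ↪o Fin n, v.detDeg (A.submatrix f g) ≤
      ((∑ i, α (Fin.castLE hk i) : ℤ) : WithBot ℤ) := by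
    rw [hA]
    exact v.detDeg_submatrix_mul_mul_le hSp' hTp' (v.detDeg_submatrix_diagonal_le hα hk)
  have : Nonempty (Fin k ↪o Fin n) := ⟨Fin.castLEOrderEmb hk⟩
  have : Finite (Fin k ↪o Fin n) := DFunLike.finite _
  obtain ⟨⟨f, g⟩, hmax⟩ := Finite.exists_max
    fun p : (Fin k ↪o Fin n) × (Fin k ↪o Fin n) => v.detDeg (A.submatrix p.1 p.2)
  refine ⟨⟨f, g, le_antisymm ?_ (hle f g)⟩, ?_⟩
  · have := v.detDeg_submatrix_mul_mul_le hSp hTp (fun f' g' => hmax (f', g'))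
      (Fin.castLEOrderEmb hk) (Fin.castLEOrderEmb hk)
    rw [hST, v.detDeg_submatrix_diagonal_self] at this
    exact this
  · rintro _ ⟨f, g, rfl⟩
    exact hle f g

end DegreeFunction

/-! ### The degree of the Dieudonné determinant -/

namespace SkewRatFunc

variable {F : Type*} [DivisionRing F] {k : ℕ}

theorem toAdd_degreeHom_list_prod (l : List (SkewRatFunc F)ˣ) :
    (degreeHom F l.prod).toAdd = (l.map fun u => (degreeHom F u).toAdd).sum := by
  induction l with
  | nil => simp
  | cons a l ih => simp [ih]

theorem toAdd_degreeHom_sign (σ : Equiv.Perm (Fin k)) :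
    (degreeHom F (Units.map (Int.castRingHom (SkewRatFunc F)).toMonoidHom
      (Equiv.Perm.sign σ))).toAdd = 0 := by
  apply degreeHom_apply
  rcases Int.units_eq_one_or (Equiv.Perm.sign σ) with h | h
  · rw [h, map_one]
    exact (degreeFunction F).deg_one
  · rw [h]
    have h1 : ((Units.map (Int.castRingHom (SkewRatFunc F)).toMonoidHom (-1) :
        (SkewRatFunc F)ˣ) : SkewRatFunc F) = ((-1 : ℤ) : SkewRatFunc F) := rfl
    rw [h1, Int.cast_neg, Int.cast_one]
    exact ((degreeFunction F).deg_neg 1).trans (degreeFunction F).deg_one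

theorem detDeg_eq_of_isBruhatForm {A : Matrix (Fin k) (Fin k) (SkewRatFunc F)}
    {d : Fin k → (SkewRatFunc F)ˣ} {σ : Equiv.Perm (Fin k)} (h : IsBruhatForm A d σ) :
    (degreeFunction F).detDeg A = ((∑ i, (degreeHom F (d i)).toAdd : ℤ) : WithBot ℤ) := by
  obtain ⟨L, U, hL, hU, rfl⟩ := h
  rw [DegreeFunction.detDeg_mul, DegreeFunction.detDeg_mul, DegreeFunction.detDeg_mul,
    DegreeFunction.detDeg_of_isLowerUnitriangular _ hL,
    DegreeFunction.detDeg_of_isUpperUnitriangular _ hU,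
    ((degreeFunction F).isBiproper_permMatrix σ).detDeg_eq, DegreeFunction.detDeg_diagonal,
    zero_add, add_zero, add_zero, WithBot.coe_sum]
  refine Finset.sum_congr rfl fun i _ => ?_
  obtain ⟨m, hm⟩ := (degreeFunction F).exists_deg_eq (d i).ne_zero
  rw [hm, degreeHom_apply hm]

theorem degDet_eq_detDeg (A : Matrix (Fin k) (Fin k) (SkewRatFunc F)) :
    degDet A = (degreeFunction F).detDeg A := by
  rw [degDet, dieudonneDet]
  split_ifs with h
  · rw [detDeg_eq_of_isBruhatForm h.choose_spec]
    simp only [WithZero.recZeroCoe_coe, bruhatClass, Abelianization.lift_apply_of, map_mul,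
      toAdd_mul, toAdd_degreeHom_sign, toAdd_degreeHom_list_prod, zero_add, List.map_ofFn,
      List.sum_ofFn]
    rfl
  · rw [DegreeFunction.detDeg_of_not_isUnit]
    · rfl
    · intro hA
      obtain ⟨d, σ, hd⟩ := exists_isBruhatForm hA
      exact h ⟨(d, σ), hd⟩

theorem isGreatest_minorDegrees {n : ℕ} {A S T : Matrix (Fin n) (Fin n) (SkewRatFunc F)}
    {α : Fin n → ℤ} (hS : IsBiproper S) (hT : IsBiproper T) (hα : Antitone α)
    (hST : S * A * T = diagPow α) (hk : k ≤ n) :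
    IsGreatest (minorDegrees A k) ((∑ i, α (Fin.castLE hk i) : ℤ) : WithBot ℤ) := by
  simp only [minorDegrees, degDet_eq_detDeg]
  exact (degreeFunction F).isGreatest_detDeg_submatrix (S := S) (T := T) hS hT hα hST hk

end SkewRatFunc

theorem proposition2p4 {F : Type*} [DivisionRing F] (n : ℕ)
    (A : Matrix (Fin n) (Fin n) (SkewRatFunc F)) (hA : IsUnit A) :
    (∃ (S T : Matrix (Fin n) (Fin n) (SkewRatFunc F)) (α : Fin n → ℤ),
      SkewRatFunc.IsBiproper S ∧ SkewRatFunc.IsBiproper T ∧ Antitone α ∧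
        S * A * T = SkewRatFunc.diagPow α) ∧
    ∃ δ : Fin (n + 1) → ℤ,
      δ 0 = 0 ∧
      (∀ k : Fin (n + 1), IsGreatest (SkewRatFunc.minorDegrees A k) (δ k : WithBot ℤ)) ∧
      ∀ (S T : Matrix (Fin n) (Fin n) (SkewRatFunc F)) (α : Fin n → ℤ),
        SkewRatFunc.IsBiproper S → SkewRatFunc.IsBiproper T → Antitone α →
        S * A * T = SkewRatFunc.diagPow α →
        ∀ k : Fin n, α k = δ k.succ - δ k.castSucc := by
  have hex : ∃ (S T : Matrix (Fin n) (Fin n) (SkewRatFunc F)) (α : Fin n → ℤ),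
      SkewRatFunc.IsBiproper S ∧ SkewRatFunc.IsBiproper T ∧ Antitone α ∧
        S * A * T = SkewRatFunc.diagPow α :=
    (SkewRatFunc.degreeFunction F).exists_smith_form hA
  refine ⟨hex, ?_⟩
  obtain ⟨S, T, α, hS, hT, hα, hST⟩ := hex
  have hmax := fun k : Fin (n + 1) =>
    SkewRatFunc.isGreatest_minorDegrees hS hT hα hST (Nat.le_of_lt_succ k.2)
  refine ⟨fun k => ∑ i : Fin k, α (Fin.castLE (Nat.le_of_lt_succ k.2) i),
    Fin.sum_univ_zero _, hmax, ?_⟩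
  intro S' T' β hS' hT' hβ hST' k
  have hsum : ∀ k : Fin (n + 1), ∑ i : Fin k, α (Fin.castLE (Nat.le_of_lt_succ k.2) i) =
      ∑ i : Fin k, β (Fin.castLE (Nat.le_of_lt_succ k.2) i) := fun k =>
    WithBot.coe_inj.1 ((hmax k).unique
      (SkewRatFunc.isGreatest_minorDegrees hS' hT' hβ hST' (Nat.le_of_lt_succ k.2)))
  simp only [hsum]
  have hk : (k.succ : ℕ) = (k : ℕ) + 1 := Fin.val_succ k
  have := Fin.sum_univ_castSucc fun i : Fin ((k : ℕ) + 1) =>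
    β (Fin.castLE (Nat.succ_le_of_lt k.2) i)
  exact eq_sub_of_add_eq' this.symm

end
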